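/- **Theorem 2.** *Setting.* Identify a Hilbert–Schmidt operator $F$ on $L^2[0,1]^2$ with its kernel $f\in L^2([0,1]^4)$; $\|F\|_2=\|f\|_{L^2}$ is the Hilbert–Schmidt norm, and $A_1\tilde\otimes A_2$ has kernel $a_1(t,t')\,a_2(s,s')$. For a trace-class $C$ on $L^2[0,1]^2$ with kernel $c$ and $\delta\in[0,1)$ let $\mathrm{Tr}^\delta(C)$ be the trace of the operator with kernel $c(t,s,t'+\delta,s'+\delta)$ ($c$ extended by zero), and let $\mathrm{Tr}_1^\delta(C)$, $\mathrm{Tr}_2^\delta(C)$ be the partial trace over the second variable of the operator with kernel $c(t,s,t',s'+\delta)$, respectively over the first variable of the operator with kernel $c(t,s,t'+\delta,s')$. For continuous $c$, $$\mathrm{Tr}^\delta(C)=\int_0^{1-\delta}\!\!\int_0^{1-\delta} c(t,s,t+\delta,s+\delta)\,dt\,ds,$$ and $\mathrm{Tr}_1^\delta(C)$, $\mathrm{Tr}_2^\delta(C)$ have the kernels $\int_0^{1-\delta}c(t,s,t',s+\delta)\,ds$ and $\int_0^{1-\delta}c(t,s,t+\delta,s')\,dt$. An operator $B$ with kernel $b$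 is *banded by* $\delta$ if $b=0$ almost everywhere on $\{\max(|t-t'|,|s-s'|)\ge\delta\}$, and *stationary* if $b(t,s,t',s')=\varsigma(|t-t'|,|s-s'|)$ almost everywhere for some function $\varsigma$. Toeplitz averaging $\mathrm{Ta}$ is the orthogonal projection, in the Hilbert–Schmidt inner product, onto the stationary operators. For trace-class $C$ with $\mathrm{Tr}^\delta(C)\ne0$ put $$A_1(\delta)=\mathrm{Tr}_1^\delta(C),\quad A_2(\delta)=\frac{\mathrm{Tr}_2^\delta(C)}{\mathrm{Tr}^\delta(C)},\quad B(\delta)=\mathrm{Ta}\big(C-A_1(\delta)\tilde\otimes A_2(\delta)\big),\quad C(\delta)=A_1(\delta)\tilde\otimes A_2(\delta)+B(\delta).$$ Given surfaces $X_1,\dots,X_N$, let $\widehat C_N=\frac1N\sum_n (X_n-\bar X_N)\otimes(X_n-\bar X_N)$, let $\widehat A_1(\delta),\widehat A_2(\delta),\widehat B(\delta),\widehat C(\delta)$ be given by the same formulas with $\widehat C_N$ in place of $C$, and let $\widehat C_{-n}(\delta)$ be $\widehat C(\delta)$ computed without $X_n$. *Statement.* Let $X_1,X_2,\dots$ be i.i.d.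 copies of a centered random element $X$ of $L^2[0,1]^2$ with $\sum_{j}\big(\mathbb E\langle X,e_j\rangle^4\big)^{1/4}<\infty$ for some orthonormal basis $(e_j)$ of $L^2[0,1]^2$, and with covariance $C=A_1\tilde\otimes A_2+B$, where $A_1,A_2,B$ are trace class and positive semi-definite, and $B$ is stationary and banded by $\delta^\star\in[0,1)$. Let $\Delta\subset[0,1)$ be a finite grid such that $\mathrm{Tr}^\delta(C)\ne0$ for all $\delta\in\Delta$ and some $\delta\in\Delta$ satisfies $\delta\ge\delta^\star$. Let $\delta^\star$ be at most the smallest minimiser over $\Delta$ of $\Xi(\delta)=\|C(\delta)-C\|_2^2$. For each $N\ge2$ let $$\widehat\delta\in\operatorname*{arg\,min}_{\delta\in\Delta}\ \|\widehat C(\delta)\|_2^2-\frac2N\sum_{n=1}^N\langle X_n,\widehat C_{-n}(\delta)X_n\rangle .$$ Then, as $N\to\infty$, $$\big\|\widehat A_1(\widehat\delta)\tilde\otimes\widehat A_2(\widehat\delta)-A_1\tilde\otimes A_2\big\|_2^2=O_P(N^{-1})\qquad\text{and}\qquad \big\|\widehat B(\widehat\delta)-B\big\|_2^2=O_P(N^{-1}).$$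 -/

import Mathlib

open MeasureTheory ProbabilityTheory Filter Topology unitInterval
open scoped ENNReal

noncomputable section

namespace SepBand

/-! ## Square-integrable functions and kernels

Hilbert-Schmidt operators on `L²(α)` are represented by their kernels `k ∈ L²(α × α)`,
`(F f)(p) = ∫ k(p, q) f(q) dq`; the Hilbert-Schmidt inner product and norm are those of
`L²(α × α)`. -/

/-- The real Hilbert space `L²(α)`. -/
abbrev L2 (α : Type*) [MeasureSpace α] : Type _ := Lp ℝ 2 (volume : Measure α)

/-- `L²[0,1]`. -/
abbrev Curve : Type := L2 I

/-- `L²[0,1]²`; the argument is `(t, s)`. -/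
abbrev Surface : Type := L2 (I × I)

/-- Kernels `a(t, t')` of Hilbert-Schmidt operators on `L²[0,1]`. -/
abbrev CurveOp : Type := L2 (I × I)

/-- Kernels `c((t, s), (t', s'))` of Hilbert-Schmidt operators on `L²[0,1]²`. -/
abbrev SurfaceOp : Type := L2 ((I × I) × (I × I))

section Outer

variable {α β : Type*} [MeasureSpace α] [MeasureSpace β]

lemma memLp_outer (x : L2 α) (y : L2 β) :
    MemLp (fun p : α × β => x p.1 * y p.2) 2 volume := by
  have hx := Lp.memLp x
  have hy := Lp.memLp y
  have hm : AEStronglyMeasurable (fun p : α × β => x p.1 * y p.2) volume :=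
    hx.1.comp_fst.mul hy.1.comp_snd
  rw [memLp_two_iff_integrable_sq hm]
  have := ((memLp_two_iff_integrable_sq hx.1).1 hx).mul_prod
    ((memLp_two_iff_integrable_sq hy.1).1 hy)
  refine this.congr (ae_of_all _ fun p => ?_)
  simp only [mul_pow]

/-- The function `(x ⊗ y)(p, q) = x(p) y(q)`. For `α = β` it is the kernel of the rank-one
operator `f ↦ ⟨y, f⟩ x`. -/
def outer (x : L2 α) (y : L2 β) : L2 (α × β) := (memLp_outer x y).toLp _

lemma coeFn_outer (x : L2 α) (y : L2 β) :
    outer x y =ᵐ[volume] fun p => x p.1 * y p.2 := (memLp_outer x y).coeFn_toLp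

lemma norm_outer [SFinite (volume : Measure α)] [SFinite (volume : Measure β)] (x : L2 α) (y : L2 β) : ‖outer x y‖ = ‖x‖ * ‖y‖ := by
  have h : ‖outer x y‖ ^ 2 = (‖x‖ * ‖y‖) ^ 2 := by
    rw [mul_pow]
    simp only [← real_inner_self_eq_norm_sq, L2.inner_def]
    rw [integral_congr_ae (g := fun p : α × β => (inner ℝ (x p.1) (x p.1) : ℝ) *
      inner ℝ (y p.2) (y p.2))]
    · exact integral_prod_mul (μ := volume) (ν := volume)
        (fun a => (inner ℝ (x a) (x a) : ℝ)) (fun b => (inner ℝ (y b) (y b) : ℝ))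
    · filter_upwards [coeFn_outer x y] with p hp
      rw [hp]
      simp only [RCLike.inner_apply, conj_trivial]
      ring
  exact (pow_left_inj₀ (norm_nonneg _) (by positivity) two_ne_zero).1 h

lemma outer_add_left (x x' : L2 α) (y : L2 β) :
    outer (x + x') y = outer x y + outer x' y := by
  apply Lp.ext
  have h : ∀ᵐ p : α × β, (x + x') p.1 = x p.1 + x' p.1 :=
    Measure.quasiMeasurePreserving_fst.ae (Lp.coeFn_add x x')
  filter_upwards [coeFn_outer (x + x') y, coeFn_outer x y, coeFn_outer x' y,
    Lp.coeFn_add (outer x y) (outer x' y), h] with p h1 h2 h3 h4 h5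
  rw [h1, h4, Pi.add_apply, h2, h3, h5, add_mul]

lemma outer_add_right (x : L2 α) (y y' : L2 β) :
    outer x (y + y') = outer x y + outer x y' := by
  apply Lp.ext
  have h : ∀ᵐ p : α × β, (y + y') p.2 = y p.2 + y' p.2 :=
    Measure.quasiMeasurePreserving_snd.ae (Lp.coeFn_add y y')
  filter_upwards [coeFn_outer x (y + y'), coeFn_outer x y, coeFn_outer x y',
    Lp.coeFn_add (outer x y) (outer x y'), h] with p h1 h2 h3 h4 h5
  rw [h1, h4, Pi.add_apply, h2, h3, h5, mul_add]

lemma outer_smul_left (r : ℝ) (x : L2 α) (y : L2 β) :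
    outer (r • x) y = r • outer x y := by
  apply Lp.ext
  have h : ∀ᵐ p : α × β, (r • x) p.1 = r • x p.1 :=
    Measure.quasiMeasurePreserving_fst.ae (Lp.coeFn_smul r x)
  filter_upwards [coeFn_outer (r • x) y, coeFn_outer x y,
    Lp.coeFn_smul r (outer x y), h] with p h1 h2 h4 h5
  rw [h1, h4, Pi.smul_apply, h2, h5, smul_eq_mul, smul_eq_mul, mul_assoc]

lemma outer_smul_right (r : ℝ) (x : L2 α) (y : L2 β) :
    outer x (r • y) = r • outer x y := by
  apply Lp.ext
  have h : ∀ᵐ p : α × β, (r • y) p.2 = r • y p.2 :=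
    Measure.quasiMeasurePreserving_snd.ae (Lp.coeFn_smul r y)
  filter_upwards [coeFn_outer x (r • y), coeFn_outer x y,
    Lp.coeFn_smul r (outer x y), h] with p h1 h2 h4 h5
  rw [h1, h4, Pi.smul_apply, h2, h5, smul_eq_mul, smul_eq_mul, mul_left_comm]

/-- `outer` as a bounded bilinear map. -/
def outerL [SFinite (volume : Measure α)] [SFinite (volume : Measure β)] :
    L2 α →L[ℝ] L2 β →L[ℝ] L2 (α × β) :=
  LinearMap.mkContinuous₂ (LinearMap.mk₂ ℝ outer outer_add_left outer_smul_left outer_add_right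
    outer_smul_right) 1 fun x y => by
      rw [one_mul, LinearMap.mk₂_apply, norm_outer]

end Outer

section Schatten

variable {α : Type*} [MeasureSpace α]

/-- The operator with kernel `k` is trace class: it has a singular value decomposition
`∑ⱼ wⱼ eⱼ ⊗ fⱼ` with `wⱼ ≥ 0`, `eⱼ` and `fⱼ` orthonormal, and `∑ⱼ wⱼ < ∞`. -/
def IsTraceClass (k : L2 (α × α)) : Prop :=
  ∃ (w : ℕ → ℝ) (e f : ℕ → L2 α), (∀ j, 0 ≤ w j) ∧ Summable w ∧
    Orthonormal ℝ e ∧ Orthonormal ℝ f ∧ HasSum (fun j => w j • outer (e j) (f j)) k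

/-- The operator with kernel `k` is self-adjoint and positive semi-definite
(note that `⟨F f, g⟩ = ⟨k, g ⊗ f⟩`). -/
def IsPSD (k : L2 (α × α)) : Prop :=
  (∀ f g : L2 α, inner ℝ k (outer g f) = inner ℝ k (outer f g)) ∧
    ∀ f : L2 α, 0 ≤ inner ℝ k (outer f f)

end Schatten

/-! ## Tensor products of operators -/

lemma measurePreserving_regroup :
    MeasurePreserving
      (fun p : (I × I) × (I × I) => ((p.1.1, p.2.1), (p.1.2, p.2.2))) volume volume := by
  have h1 : MeasurePreserving
      (fun p : I × (I × I) => (p.2.1, (p.1, p.2.2))) volume volume := by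
    have e1 := (measurePreserving_prodAssoc (volume : Measure I) (volume : Measure I)
      (volume : Measure I)).symm
    have e2 := (Measure.measurePreserving_swap (μ := (volume : Measure I))
      (ν := (volume : Measure I))).prod (MeasurePreserving.id (volume : Measure I))
    have e3 := measurePreserving_prodAssoc (volume : Measure I) (volume : Measure I)
      (volume : Measure I)
    exact e3.comp (e2.comp e1)
  have e1 := measurePreserving_prodAssoc (volume : Measure I) (volume : Measure I)
    (volume : Measure (I × I))
  have e2 := (MeasurePreserving.id (volume : Measure I)).prod h1
  have e3 := (measurePreserving_prodAssoc (volume : Measure I) (volume : Measure I)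
    (volume : Measure (I × I))).symm
  exact e3.comp (e2.comp e1)

/-- The regrouping of variables `k((t, t'), (s, s')) ↦ k((t, s), (t', s'))`. -/
def regroup : L2 ((I × I) × (I × I)) →ₗᵢ[ℝ] SurfaceOp :=
  Lp.compMeasurePreservingₗᵢ ℝ _ measurePreserving_regroup

/-- The tensor product of two operators on `L²[0,1]`, an operator on `L²[0,1]²`. Its kernel is
`(a₁ ⊗̃ a₂)((t, s), (t', s')) = a₁(t, t') a₂(s, s')`. -/
def opTensor (a₁ a₂ : CurveOp) : SurfaceOp := regroup (outer a₁ a₂)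

lemma coeFn_opTensor (a₁ a₂ : CurveOp) : opTensor a₁ a₂ =ᵐ[volume]
    fun p => a₁ (p.1.1, p.2.1) * a₂ (p.1.2, p.2.2) := by
  have h1 : opTensor a₁ a₂ =ᵐ[volume] outer a₁ a₂ ∘ _ :=
    Lp.coeFn_compMeasurePreserving (outer a₁ a₂) measurePreserving_regroup
  have h2 := measurePreserving_regroup.quasiMeasurePreserving.ae (coeFn_outer a₁ a₂)
  filter_upwards [h1, h2] with p h3 h4
  rw [h3, Function.comp_apply, h4]

/-- The kernel `(t, t') ↦ ∫∫ k((t, s), (t', s')) c(s, s') ds ds'`, as the adjoint of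
`a ↦ a ⊗̃ c`. -/
def contractSnd (c : CurveOp) : SurfaceOp →L[ℝ] CurveOp :=
  ContinuousLinearMap.adjoint
    (regroup.toContinuousLinearMap ∘L (outerL (α := I × I) (β := I × I)).flip c)

/-- The kernel `(s, s') ↦ ∫∫ k((t, s), (t', s')) c(t, t') dt dt'`, as the adjoint of
`a ↦ c ⊗̃ a`. -/
def contractFst (c : CurveOp) : SurfaceOp →L[ℝ] CurveOp :=
  ContinuousLinearMap.adjoint
    (regroup.toContinuousLinearMap ∘L outerL (α := I × I) (β := I × I) c)

lemma inner_contractSnd (c a : CurveOp) (k : SurfaceOp) :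
    inner ℝ (contractSnd c k) a = inner ℝ k (opTensor a c) := by
  rw [contractSnd, ContinuousLinearMap.adjoint_inner_left]
  rfl

lemma inner_contractFst (c a : CurveOp) (k : SurfaceOp) :
    inner ℝ (contractFst c k) a = inner ℝ k (opTensor c a) := by
  rw [contractFst, ContinuousLinearMap.adjoint_inner_left]
  rfl

/-! ## Shifted partial tracing -/

/-- Extension of a function on `[0,1]` by zero. -/
def extZero (f : I → ℝ) (x : ℝ) : ℝ := if h : x ∈ I then f ⟨x, h⟩ else 0

lemma memLp_shift (δ : ℝ) (f : Curve) :
    MemLp (fun s : I => extZero f (s - δ)) 2 volume := by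
  have hemb := unitInterval.measurableEmbedding_coe
  have hmap : Measure.map ((↑) : I → ℝ) volume = volume.restrict I :=
    unitInterval.measurePreserving_coe.map_eq
  have hcomp : (extZero f) ∘ ((↑) : I → ℝ) = f := by
    funext s
    simp [extZero]
  have h1 : MemLp (extZero f) 2 (volume.restrict I) := by
    rw [← hmap, hemb.memLp_map_measure_iff, hcomp]
    exact Lp.memLp f
  have hind : Set.indicator I (extZero f) = extZero f := by
    funext x
    by_cases hx : x ∈ I
    · simp only [Set.indicator_of_mem hx]
    · rw [Set.indicator_of_notMem hx, extZero, dif_neg hx]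
  have h2 : MemLp (extZero f) 2 volume := by
    rw [← hind]
    exact (memLp_indicator_iff_restrict measurableSet_Icc).2 h1
  have h3 : MemLp (fun x : ℝ => extZero f (x - δ)) 2 volume :=
    h2.comp_measurePreserving (measurePreserving_sub_right volume δ)
  have h4 : MemLp (fun x : ℝ => extZero f (x - δ)) 2 (Measure.map ((↑) : I → ℝ) volume) := by
    rw [hmap]
    exact h3.restrict _
  exact (hemb.memLp_map_measure_iff).1 h4

/-- The shift `(U f)(s) = f(s - δ)`, with `f` extended by zero. For an operator `F` with kernel
`k(t, s)` the operator `F U` has the kernel `k(t, s + δ)`, set to zero for `s > 1 - δ`. -/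
def shift (δ : ℝ) (f : Curve) : Curve := (memLp_shift δ f).toLp _

/-- The index set of an orthonormal basis of `L²[0,1]`. -/
def basisIndex : Set Curve := (exists_hilbertBasis ℝ Curve).choose

/-- An orthonormal basis of `L²[0,1]`, used to evaluate traces; the choice is immaterial for
trace-class operators. -/
def basis : HilbertBasis basisIndex ℝ Curve :=
  (exists_hilbertBasis ℝ Curve).choose_spec.choose

/-- `eⱼ ⊗ U eⱼ` for a basis function `eⱼ`; the shifted trace of an operator on `L²[0,1]` with
kernel `k` is `∑ⱼ ⟨k, eⱼ ⊗ U eⱼ⟩`, which is `∫ k(t, t + δ) dt` over `[0, 1 - δ]` if `k` is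
continuous. -/
def shiftedDiag (δ : ℝ) (j : basisIndex) : CurveOp := outer (basis j) (shift δ (basis j))

/-- The shifted trace of a trace-class operator on `L²[0,1]²`: the trace of the operator with
kernel `c((t, s), (t' + δ, s' + δ))`, evaluated in the orthonormal basis `eᵢ ⊗ eⱼ`. For
continuous `c` it is `∫∫ c((t, s), (t + δ, s + δ)) dt ds` over `[0, 1 - δ]²`. -/
def shiftedTrace (δ : ℝ) (c : SurfaceOp) : ℝ :=
  ∑' ij : basisIndex × basisIndex,
    inner ℝ c (opTensor (shiftedDiag δ ij.1) (shiftedDiag δ ij.2))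

/-- The first shifted partial trace: the partial trace over the second variable of the operator
with kernel `c((t, s), (t', s' + δ))`. For continuous `c` its kernel is
`(t, t') ↦ ∫ c((t, s), (t', s + δ)) ds` over `[0, 1 - δ]`. -/
def shiftedPartialTrace₁ (δ : ℝ) (c : SurfaceOp) : CurveOp :=
  ∑' j : basisIndex, contractSnd (shiftedDiag δ j) c

/-- The second shifted partial trace: the partial trace over the first variable of the operator
with kernel `c((t, s), (t' + δ, s'))`. For continuous `c` its kernel is
`(s, s') ↦ ∫ c((t, s), (t + δ, s')) dt` over `[0, 1 - δ]`. -/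
def shiftedPartialTrace₂ (δ : ℝ) (c : SurfaceOp) : CurveOp :=
  ∑' j : basisIndex, contractFst (shiftedDiag δ j) c

/-! ## Banded and stationary operators, Toeplitz averaging -/

/-- `b` is banded by `δ`: it vanishes almost everywhere on `{max(|t - t'|, |s - s'|) ≥ δ}`. -/
def IsBanded (δ : ℝ) (b : SurfaceOp) : Prop :=
  ∀ᵐ p : (I × I) × (I × I),
    δ ≤ max |(p.1.1 : ℝ) - p.2.1| |(p.1.2 : ℝ) - p.2.2| → b p = 0

/-- The stationary operators: those with a translation-invariant kernel
`b((t, s), (t', s')) = ς(|t - t'|, |s - s'|)`. -/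
def stationary : Submodule ℝ SurfaceOp where
  carrier := {b | ∃ ς : ℝ × ℝ → ℝ, Measurable ς ∧ ∀ᵐ p : (I × I) × (I × I),
    b p = ς (|(p.1.1 : ℝ) - p.2.1|, |(p.1.2 : ℝ) - p.2.2|)}
  add_mem' := by
    rintro b b' ⟨ς, hm, h⟩ ⟨ς', hm', h'⟩
    refine ⟨ς + ς', hm.add hm', ?_⟩
    filter_upwards [h, h', Lp.coeFn_add b b'] with p h1 h2 h3
    rw [h3, Pi.add_apply, h1, h2, Pi.add_apply]
  zero_mem' := by
    refine ⟨0, measurable_zero, ?_⟩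
    filter_upwards [Lp.coeFn_zero ℝ 2 (volume : Measure ((I × I) × (I × I)))] with p h
    rw [h]
    rfl
  smul_mem' := by
    rintro r b ⟨ς, hm, h⟩
    refine ⟨r • ς, hm.const_smul r, ?_⟩
    filter_upwards [h, Lp.coeFn_smul r b] with p h1 h2
    rw [h2, Pi.smul_apply, h1, Pi.smul_apply]

/-- Toeplitz averaging: the orthogonal projection, in the Hilbert-Schmidt inner product, onto the
(closed) subspace of stationary operators. -/
def toeplitzAvg : SurfaceOp →L[ℝ] SurfaceOp :=
  stationary.topologicalClosure.starProjection

/-! ## The estimators -/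

/-- The separable part `A₁(δ) ⊗̃ A₂(δ)` extracted from `c` by shifted partial tracing, where
`A₁(δ) = Tr₁(c)` and `A₂(δ) = Tr₂(c) / Tr(c)`. -/
def separablePart (δ : ℝ) (c : SurfaceOp) : SurfaceOp :=
  opTensor (shiftedPartialTrace₁ δ c) ((shiftedTrace δ c)⁻¹ • shiftedPartialTrace₂ δ c)

/-- The stationary part `B(δ) = Ta(c - A₁(δ) ⊗̃ A₂(δ))`. -/
def bandedPart (δ : ℝ) (c : SurfaceOp) : SurfaceOp := toeplitzAvg (c - separablePart δ c)

/-- The separable-plus-banded proxy `C(δ) = A₁(δ) ⊗̃ A₂(δ) + B(δ)` of `c`. -/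
def proxy (δ : ℝ) (c : SurfaceOp) : SurfaceOp := separablePart δ c + bandedPart δ c

/-- The mean of the surfaces `xₙ`, `n ∈ S`. -/
def sampleMean (x : ℕ → Surface) (S : Finset ℕ) : Surface :=
  (S.card : ℝ)⁻¹ • ∑ n ∈ S, x n

/-- The empirical covariance of the surfaces `xₙ`, `n ∈ S`. -/
def empCov (x : ℕ → Surface) (S : Finset ℕ) : SurfaceOp :=
  (S.card : ℝ)⁻¹ • ∑ n ∈ S, outer (x n - sampleMean x S) (x n - sampleMean x S)

/-- The leave-one-out cross-validation criterion
`‖Ĉ(δ)‖² - (2/N) ∑ₙ ⟨xₙ, Ĉ₋ₙ(δ) xₙ⟩` for the sample `x₀, …, x_{N-1}`, where `Ĉ₋ₙ(δ)` is the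
estimator constructed without `xₙ`. -/
def cvCriterion (x : ℕ → Surface) (N : ℕ) (δ : ℝ) : ℝ :=
  ‖proxy δ (empCov x (Finset.range N))‖ ^ 2 -
    2 / (N : ℝ) * ∑ n ∈ Finset.range N,
      inner ℝ (proxy δ (empCov x ((Finset.range N).erase n))) (outer (x n) (x n))

/-- The theoretical criterion `‖C(δ) - C‖²`. -/
def theoreticalCriterion (c : SurfaceOp) (δ : ℝ) : ℝ := ‖proxy δ c - c‖ ^ 2

/-- The set of minimisers of `f` over the grid `Δ`. -/
def argminOn (Δ : Finset ℝ) (f : ℝ → ℝ) : Set ℝ := {δ | δ ∈ Δ ∧ ∀ δ' ∈ Δ, f δ ≤ f δ'}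

/-! ## Probability -/

section Probability

variable {Ω : Type*} [MeasurableSpace Ω]

/-- The covariance `E[(X - EX) ⊗ (X - EX)]` of a random surface. -/
def covariance (P : Measure Ω) (X : Ω → Surface) : SurfaceOp :=
  ∫ ω, outer (X ω - ∫ ω', X ω' ∂P) (X ω - ∫ ω', X ω' ∂P) ∂P

/-- The moment condition `∑ⱼ (E ⟨X, eⱼ⟩⁴)^{1/4} < ∞` for some orthonormal basis `(eⱼ)` of
`L²[0,1]²`. -/
def MomentCondition (P : Measure Ω) (X : Ω → Surface) : Prop :=
  ∃ e : HilbertBasis ℕ ℝ Surface,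
    ∑' j, eLpNorm (fun ω => (inner ℝ (X ω) (e j) : ℝ)) 4 P < ∞

/-- `R_N = O_P(r_N)` as `N → ∞`. -/
def IsBigOInProbability (P : Measure Ω) (R : ℕ → Ω → ℝ) (r : ℕ → ℝ) : Prop :=
  ∀ ε : ℝ, 0 < ε → ∃ M : ℝ, 0 < M ∧
    ∀ᶠ N in atTop, P {ω | M * r N < |R N ω|} ≤ ENNReal.ofReal ε

end Probability

end SepBand

end

noncomputable section

namespace SepBand

/-! ### Parseval and Bessel bounds for images of an orthonormal basis. -/

section Hilbert

variable {ι κ H K : Type*} [NormedAddCommGroup H] [InnerProductSpace ℝ H]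
  [NormedAddCommGroup K] [InnerProductSpace ℝ K]

/-! At the population level the estimator is exact once `δ ≥ δstar`. The shifted traces then
annihilate `B` (`IsBanded.shiftedPartialTrace₁_eq_zero` and its companions), and on `A₁ ⊗̃ A₂` they
return scalar multiples of the factors whose scalars cancel in the normalisation. Hence the
separable part of `C` is `A₁ ⊗̃ A₂` (`separablePart_opTensor_add`), and Toeplitz averaging fixes the
stationary remainder `B`. So `Ξ` attains the value zero on the grid, its minimisers are its zeros,
and by assumption all of them are at least `δstar`.

For the annihilation, kernels are only almost everywhere classes and have no diagonal. A shifted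
trace is therefore rewritten, free of the basis, through a sum of rank-one kernels
(`tsum_inner_opTensor_eq`). For `δ > δstar` the interval is cut into cells shorter than `δ - δstar`,
and the kernel vanishes wherever a cell meets its own translate by `δ`. The case `δ = δstar` follows
by continuity of translations in `L²`.

For the rate, shifted traces are not controlled by the Hilbert-Schmidt norm. They are controlled by
`coeffNorm`, the absolute sum of coefficients in the basis `eᵢ ⊗ eⱼ` of the moment condition, which
bounds the cost of one nuclear decomposition. In this norm the separable part is locally Lipschitz
at `C` (`exists_norm_separablePart_sub_le`), and the empirical covariance is within `O_P(N^{-1/2})`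
of `C` by coordinatewise variance bounds.

For the choice of bandwidth, a sample is called typical if its moments are close to the true ones
and no observation dominates. All leave-one-out covariances are then close to `C`, so on the finite
grid the criterion is uniformly close to `Ξ - ‖C‖²`. No `δ` with `Ξ(δ) > 0` can minimise it, which
forces `δhat ≥ δstar` (`eventually_le_of_mem_argminOn_cvCriterion`). Samples fail to be typical with
small probability, and on typical ones exactness and the Lipschitz bound give both rates. -/

lemma tsum_enorm_inner_sq (b : HilbertBasis ι ℝ H) (x : H) :
    ∑' i, ‖(inner ℝ x (b i) : ℝ)‖ₑ ^ 2 = ‖x‖ₑ ^ 2 := by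
  have h := b.hasSum_inner_mul_inner x x
  rw [real_inner_self_eq_norm_sq] at h
  have h2 : ∀ i, ‖(inner ℝ x (b i) : ℝ)‖ₑ ^ 2
      = ENNReal.ofReal (inner ℝ x (b i) * inner ℝ (b i) x) := fun i => by
    rw [real_inner_comm x (b i), ← pow_two, Real.enorm_eq_ofReal_abs,
      ← ENNReal.ofReal_pow (abs_nonneg _), sq_abs, real_inner_comm]
  simp_rw [h2]
  rw [← ENNReal.ofReal_tsum_of_nonneg _ h.summable, h.tsum_eq,
    ENNReal.ofReal_pow (norm_nonneg _), ofReal_norm]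
  intro i
  rw [real_inner_comm]
  exact mul_self_nonneg _

lemma tsum_mul_le_of_sq_le {f g : ι → ℝ≥0∞} {A B : ℝ≥0∞} (hf : ∑' i, f i ^ 2 ≤ A ^ 2)
    (hg : ∑' i, g i ^ 2 ≤ B ^ 2) : ∑' i, f i * g i ≤ A * B := by
  refine ENNReal.summable.tsum_le_of_sum_le fun s => ?_
  have hs : ∀ (f : ι → ℝ≥0∞) (A : ℝ≥0∞), ∑' i, f i ^ 2 ≤ A ^ 2 →
      (∑ i ∈ s, f i ^ (2 : ℝ)) ^ (1 / (2 : ℝ)) ≤ A := by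
    intro f A h
    have h1 : ∑ i ∈ s, f i ^ (2 : ℝ) ≤ A ^ (2 : ℝ) := by
      simp only [ENNReal.rpow_two]
      exact (ENNReal.sum_le_tsum s).trans h
    calc _ ≤ (A ^ (2 : ℝ)) ^ (1 / (2 : ℝ)) := by gcongr
      _ = A := by rw [← ENNReal.rpow_mul]; norm_num
  refine (ENNReal.inner_le_Lp_mul_Lq s f g Real.HolderConjugate.two_two).trans ?_
  exact mul_le_mul' (hs f A hf) (hs g B hg)

/-- Parseval for the adjoint image of `x`, whose norm is at most that of `x`. The images of the
basis need not be orthogonal. -/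
lemma tsum_enorm_inner_map_sq_le [CompleteSpace H] [CompleteSpace K] (b : HilbertBasis ι ℝ H)
    {V : H →L[ℝ] K} (hV : ‖V‖ ≤ 1) (x : K) :
    ∑' i, ‖(inner ℝ x (V (b i)) : ℝ)‖ₑ ^ 2 ≤ ‖x‖ₑ ^ 2 := by
  simp_rw [← ContinuousLinearMap.adjoint_inner_left]
  rw [tsum_enorm_inner_sq]
  gcongr
  rw [enorm_le_iff_norm_le]
  refine ((ContinuousLinearMap.adjoint V).le_opNorm x).trans ?_
  rw [LinearIsometryEquiv.norm_map]
  exact mul_le_of_le_one_left (norm_nonneg _) hV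

/-- Parseval after moving both operators to the other side. The value does not involve the basis;
this is what allows cut-offs to be inserted into traces later. -/
lemma hasSum_inner_map_mul_inner_map [CompleteSpace H] [CompleteSpace K]
    (b : HilbertBasis ι ℝ H) (W V : H →L[ℝ] K) (x y : K) :
    HasSum (fun i => (inner ℝ x (W (b i)) : ℝ) * inner ℝ y (V (b i)))
      (inner ℝ (V (ContinuousLinearMap.adjoint W x)) y) := by
  have h := b.hasSum_inner_mul_inner (ContinuousLinearMap.adjoint W x)
    (ContinuousLinearMap.adjoint V y)
  rw [ContinuousLinearMap.adjoint_inner_right] at h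
  have e : (fun i => (inner ℝ x (W (b i)) : ℝ) * inner ℝ y (V (b i))) = fun i =>
      (inner ℝ (ContinuousLinearMap.adjoint W x) (b i) : ℝ) *
        inner ℝ (b i) (ContinuousLinearMap.adjoint V y) := funext fun i => by
    rw [ContinuousLinearMap.adjoint_inner_left, ContinuousLinearMap.adjoint_inner_right,
      real_inner_comm y]
  rw [e]
  exact h

lemma tsum_enorm_inner_map_mul_inner_map_le [CompleteSpace H] [CompleteSpace K]
    (b : HilbertBasis ι ℝ H) {W V : H →L[ℝ] K} (hW : ‖W‖ ≤ 1) (hV : ‖V‖ ≤ 1) (x y : K) :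
    ∑' i, ‖(inner ℝ x (W (b i)) : ℝ)‖ₑ * ‖(inner ℝ y (V (b i)) : ℝ)‖ₑ ≤ ‖x‖ₑ * ‖y‖ₑ :=
  tsum_mul_le_of_sq_le (tsum_enorm_inner_map_sq_le b hW x) (tsum_enorm_inner_map_sq_le b hV y)

end Hilbert

/-! ### Products of functions are total; slices and product bases. -/

section Total

variable {α β : Type*} [MeasureSpace α] [MeasureSpace β]

@[simp]
lemma outerL_apply [SFinite (volume : Measure α)] [SFinite (volume : Measure β)]
    (x : L2 α) (y : L2 β) : outerL x y = outer x y := rfl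

lemma inner_outer_outer [SFinite (volume : Measure α)] [SFinite (volume : Measure β)]
    (x x' : L2 α) (y y' : L2 β) :
    (inner ℝ (outer x y) (outer x' y') : ℝ) = inner ℝ x x' * inner ℝ y y' := by
  simp only [L2.inner_def]
  rw [integral_congr_ae (g := fun p : α × β => (inner ℝ (x p.1) (x' p.1) : ℝ) *
      inner ℝ (y p.2) (y' p.2))]
  · exact integral_prod_mul (μ := volume) (ν := volume)
      (fun a => (inner ℝ (x a) (x' a) : ℝ)) (fun b => (inner ℝ (y b) (y' b) : ℝ))
  · filter_upwards [coeFn_outer x y, coeFn_outer x' y'] with p hp hp'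
    rw [hp, hp']
    simp only [RCLike.inner_apply, conj_trivial]
    ring

/-- Testing against indicators makes the integral over every measurable rectangle vanish, and the
π-λ theorem extends this to all measurable sets. -/
lemma eq_zero_of_inner_outer_eq_zero [IsFiniteMeasure (volume : Measure α)]
    [IsFiniteMeasure (volume : Measure β)] {k : L2 (α × β)}
    (h : ∀ f g, (inner ℝ k (outer f g) : ℝ) = 0) : k = 0 := by
  have hint : Integrable k volume := (Lp.memLp k).integrable (by norm_num)
  have hrect : ∀ s t, MeasurableSet s → MeasurableSet t →
      ∫ p in s ×ˢ t, k p = 0 := by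
    intro s t hs ht
    have := h (indicatorConstLp 2 hs (measure_ne_top volume s) 1)
      (indicatorConstLp 2 ht (measure_ne_top volume t) 1)
    rw [L2.inner_def] at this
    rw [← this, ← integral_indicator (hs.prod ht)]
    refine integral_congr_ae ?_
    have h1 := (Measure.quasiMeasurePreserving_fst (μ := (volume : Measure α))
      (ν := (volume : Measure β))).ae (indicatorConstLp_coeFn (p := 2) (hs := hs)
        (hμs := measure_ne_top volume s) (c := (1 : ℝ)))
    have h2 := (Measure.quasiMeasurePreserving_snd (μ := (volume : Measure α))
      (ν := (volume : Measure β))).ae (indicatorConstLp_coeFn (p := 2) (hs := ht)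
        (hμs := measure_ne_top volume t) (c := (1 : ℝ)))
    filter_upwards [coeFn_outer (indicatorConstLp 2 hs (measure_ne_top volume s) (1 : ℝ))
      (indicatorConstLp 2 ht (measure_ne_top volume t) (1 : ℝ)), h1, h2] with p h3 h4 h5
    rw [h3, h4, h5]
    by_cases hps : p.1 ∈ s <;> by_cases hpt : p.2 ∈ t <;>
      simp [Set.indicator, hps, hpt]
  have hall : ∀ s : Set (α × β), MeasurableSet s → ∫ p in s, k p = 0 := by
    intro s hs
    induction s, hs using MeasurableSpace.induction_on_inter generateFrom_prod.symm
      isPiSystem_prod with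
    | empty => simp
    | basic u hu =>
      obtain ⟨s, hs, t, ht, rfl⟩ := hu
      exact hrect s t hs ht
    | compl u hu ih =>
      rw [setIntegral_compl hu hint, ih, sub_zero, ← setIntegral_univ, ← Set.univ_prod_univ]
      exact hrect _ _ MeasurableSet.univ MeasurableSet.univ
    | iUnion f hd hf ih =>
      rw [integral_iUnion hf hd hint.integrableOn]
      simp [ih]
  rw [Lp.eq_zero_iff_ae_eq_zero]
  exact hint.ae_eq_zero_of_forall_setIntegral_eq_zero fun s hs _ => hall s hs

lemma ext_inner_outer [IsFiniteMeasure (volume : Measure α)]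
    [IsFiniteMeasure (volume : Measure β)] {k l : L2 (α × β)}
    (h : ∀ f g, (inner ℝ k (outer f g) : ℝ) = inner ℝ l (outer f g)) : k = l :=
  sub_eq_zero.1 <| eq_zero_of_inner_outer_eq_zero fun f g => by
    rw [inner_sub_left, h, sub_self]

/-- The slice `⟨sliceFst u x, g⟩ = ⟨x, u ⊗ g⟩`. -/
def sliceFst [SFinite (volume : Measure α)] [SFinite (volume : Measure β)] (u : L2 α) :
    L2 (α × β) →L[ℝ] L2 β := ContinuousLinearMap.adjoint (outerL u)

/-- The slice `⟨sliceSnd v x, f⟩ = ⟨x, f ⊗ v⟩`. -/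
def sliceSnd [SFinite (volume : Measure α)] [SFinite (volume : Measure β)] (v : L2 β) :
    L2 (α × β) →L[ℝ] L2 α := ContinuousLinearMap.adjoint (outerL.flip v)

lemma inner_sliceFst [SFinite (volume : Measure α)] [SFinite (volume : Measure β)]
    (u : L2 α) (g : L2 β) (x : L2 (α × β)) :
    (inner ℝ (sliceFst u x) g : ℝ) = inner ℝ x (outer u g) := by
  rw [sliceFst, ContinuousLinearMap.adjoint_inner_left, outerL_apply]

lemma inner_sliceSnd [SFinite (volume : Measure α)] [SFinite (volume : Measure β)]
    (v : L2 β) (f : L2 α) (x : L2 (α × β)) :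
    (inner ℝ (sliceSnd v x) f : ℝ) = inner ℝ x (outer f v) := by
  rw [sliceSnd, ContinuousLinearMap.adjoint_inner_left]
  rfl

lemma norm_sliceFst_le [SFinite (volume : Measure α)] [SFinite (volume : Measure β)] (u : L2 α)
    (x : L2 (α × β)) : ‖sliceFst u x‖ ≤ ‖u‖ * ‖x‖ := by
  refine ((sliceFst u).le_opNorm x).trans ?_
  gcongr
  rw [sliceFst, LinearIsometryEquiv.norm_map]
  refine ContinuousLinearMap.opNorm_le_bound _ (norm_nonneg _) fun y => ?_
  rw [outerL_apply, norm_outer]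

variable {ι κ : Type*}

lemma orthonormal_outer [SFinite (volume : Measure α)] [SFinite (volume : Measure β)]
    {b : ι → L2 α} {c : κ → L2 β} (hb : Orthonormal ℝ b) (hc : Orthonormal ℝ c) :
    Orthonormal ℝ (fun p : ι × κ => outer (b p.1) (c p.2)) := by
  classical
  rw [orthonormal_iff_ite] at *
  rintro ⟨i, j⟩ ⟨i', j'⟩
  rw [inner_outer_outer, hb, hc]
  by_cases h : i = i' <;> by_cases h' : j = j' <;> simp [h, h']

/-- The tensor product of two orthonormal bases. -/
def outerBasis [IsFiniteMeasure (volume : Measure α)] [IsFiniteMeasure (volume : Measure β)]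
    (b : HilbertBasis ι ℝ (L2 α)) (c : HilbertBasis κ ℝ (L2 β)) :
    HilbertBasis (ι × κ) ℝ (L2 (α × β)) :=
  HilbertBasis.mkOfOrthogonalEqBot (orthonormal_outer b.orthonormal c.orthonormal) <| by
    rw [Submodule.eq_bot_iff]
    intro k hk
    refine eq_zero_of_inner_outer_eq_zero fun f g => ?_
    have hz : ∀ i j, (inner ℝ k (outer (b i) (c j)) : ℝ) = 0 := fun i j =>
      Submodule.inner_left_of_mem_orthogonal
        (Submodule.subset_span (Set.mem_range_self (i, j))) hk
    have h1 : ∀ i, sliceFst (b i) k = 0 := fun i => by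
      rw [← enorm_eq_zero, ← pow_eq_zero_iff two_ne_zero, ← tsum_enorm_inner_sq c]
      simp [inner_sliceFst, hz]
    have h2 : sliceSnd g k = 0 := by
      rw [← enorm_eq_zero, ← pow_eq_zero_iff two_ne_zero, ← tsum_enorm_inner_sq b]
      simp [inner_sliceSnd, ← inner_sliceFst, h1]
    rw [← inner_sliceSnd, h2, inner_zero_left]

@[simp]
lemma outerBasis_apply [IsFiniteMeasure (volume : Measure α)]
    [IsFiniteMeasure (volume : Measure β)]
    (b : HilbertBasis ι ℝ (L2 α)) (c : HilbertBasis κ ℝ (L2 β)) (p : ι × κ) :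
    outerBasis b c p = outer (b p.1) (c p.2) := by
  rw [outerBasis, HilbertBasis.coe_mkOfOrthogonalEqBot]

/-- The tensor product operator is never formed: one contraction is removed at a time, by the
one-factor bound applied to slices, with the order of summation exchanged in between. -/
lemma tsum_enorm_inner_outer_map_sq_le [IsFiniteMeasure (volume : Measure α)]
    [IsFiniteMeasure (volume : Measure β)] (b : HilbertBasis ι ℝ (L2 α))
    (c : HilbertBasis κ ℝ (L2 β)) {V : L2 α →L[ℝ] L2 α} {W : L2 β →L[ℝ] L2 β}
    (hV : ‖V‖ ≤ 1) (hW : ‖W‖ ≤ 1) (y : L2 (α × β)) :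
    ∑' p : ι × κ, ‖(inner ℝ y (outer (V (b p.1)) (W (c p.2))) : ℝ)‖ₑ ^ 2 ≤ ‖y‖ₑ ^ 2 := by
  rw [ENNReal.tsum_prod (f := fun i j => ‖(inner ℝ y (outer (V (b i)) (W (c j))) : ℝ)‖ₑ ^ 2)]
  calc _ ≤ ∑' i, ‖sliceFst (V (b i)) y‖ₑ ^ 2 := by
        gcongr with i
        simp_rw [← inner_sliceFst]
        exact tsum_enorm_inner_map_sq_le c hW _
    _ = ∑' i, ∑' j, ‖(inner ℝ y (outer (V (b i)) (c j)) : ℝ)‖ₑ ^ 2 := by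
        simp_rw [← tsum_enorm_inner_sq c, inner_sliceFst]
    _ = ∑' j, ∑' i, ‖(inner ℝ y (outer (V (b i)) (c j)) : ℝ)‖ₑ ^ 2 := ENNReal.tsum_comm
    _ ≤ ∑' j, ‖sliceSnd (c j) y‖ₑ ^ 2 := by
        gcongr with j
        simp_rw [← inner_sliceSnd]
        exact tsum_enorm_inner_map_sq_le b hV _
    _ = ∑' j, ∑' i, ‖(inner ℝ y (outer (b i) (c j)) : ℝ)‖ₑ ^ 2 := by
        simp_rw [← tsum_enorm_inner_sq b, inner_sliceSnd]
    _ = ∑' i, ∑' j, ‖(inner ℝ y (outer (b i) (c j)) : ℝ)‖ₑ ^ 2 := ENNReal.tsum_comm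
    _ = ‖y‖ₑ ^ 2 := by
        rw [← tsum_enorm_inner_sq (outerBasis b c), ENNReal.tsum_prod']
        simp only [outerBasis_apply]

end Total

/-! ### Rank-one calculus for tensor products and contractions. -/

section OpTensor

/-- Regrouping the variables turns a tensor product of rank-one operators into a rank-one operator
on surfaces. Contractions of rank-one kernels thereby reduce to slices. -/
lemma opTensor_outer_outer (f g u v : Curve) :
    opTensor (outer f g) (outer u v) = outer (outer f u) (outer g v) := by
  apply Lp.ext
  have e1 := measurePreserving_regroup.quasiMeasurePreserving
  have h1 : ∀ᵐ p : (I × I) × (I × I), outer f g (p.1.1, p.2.1) = f p.1.1 * g p.2.1 :=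
    (Measure.quasiMeasurePreserving_fst.comp e1).ae (coeFn_outer f g)
  have h2 : ∀ᵐ p : (I × I) × (I × I), outer u v (p.1.2, p.2.2) = u p.1.2 * v p.2.2 :=
    (Measure.quasiMeasurePreserving_snd.comp e1).ae (coeFn_outer u v)
  have h3 := (Measure.quasiMeasurePreserving_fst (μ := (volume : Measure (I × I)))
    (ν := (volume : Measure (I × I)))).ae (coeFn_outer f u)
  have h4 := (Measure.quasiMeasurePreserving_snd (μ := (volume : Measure (I × I)))
    (ν := (volume : Measure (I × I)))).ae (coeFn_outer g v)
  filter_upwards [coeFn_opTensor (outer f g) (outer u v), h1, h2, h3, h4,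
    coeFn_outer (outer f u) (outer g v)] with p h5 h6 h7 h8 h9 h10
  rw [h5, h6, h7, h10, h8, h9]
  ring

/-- `opTensor` as a bounded bilinear map. -/
def opTensorL : CurveOp →L[ℝ] CurveOp →L[ℝ] SurfaceOp :=
  (ContinuousLinearMap.compL ℝ _ _ _ regroup.toContinuousLinearMap) ∘L outerL

@[simp]
lemma opTensorL_apply (a b : CurveOp) : opTensorL a b = opTensor a b := rfl

lemma inner_opTensor_opTensor (a b a' b' : CurveOp) :
    (inner ℝ (opTensor a b) (opTensor a' b') : ℝ) = inner ℝ a a' * inner ℝ b b' := by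
  rw [opTensor, opTensor, LinearIsometry.inner_map_map, inner_outer_outer]

lemma contractSnd_outer_outer (u v : Curve) (x y : Surface) :
    contractSnd (outer u v) (outer x y) = outer (sliceSnd u x) (sliceSnd v y) := by
  refine ext_inner_outer fun f g => ?_
  rw [inner_contractSnd, opTensor_outer_outer, inner_outer_outer, inner_outer_outer,
    inner_sliceSnd, inner_sliceSnd]

lemma contractSnd_opTensor (c a b : CurveOp) :
    contractSnd c (opTensor a b) = (inner ℝ b c : ℝ) • a := by
  refine ext_inner_right ℝ fun v => ?_
  rw [inner_contractSnd, inner_opTensor_opTensor, inner_smul_left]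
  simp [mul_comm]

end OpTensor

/-! ### The shift as a contraction, strongly continuous in `δ`. -/

section Shift

lemma extZero_comp_coe (f : I → ℝ) : extZero f ∘ ((↑) : I → ℝ) = f := by
  funext s
  simp [extZero]

lemma indicator_extZero (f : I → ℝ) : Set.indicator I (extZero f) = extZero f := by
  funext x
  by_cases hx : x ∈ I
  · simp only [Set.indicator_of_mem hx]
  · rw [Set.indicator_of_notMem hx, extZero, dif_neg hx]

lemma eLpNorm_extZero (f : I → ℝ) : eLpNorm (extZero f) 2 volume = eLpNorm f 2 volume := by
  rw [← indicator_extZero, eLpNorm_indicator_eq_eLpNorm_restrict measurableSet_Icc,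
    ← unitInterval.measurePreserving_coe.map_eq,
    unitInterval.measurableEmbedding_coe.eLpNorm_map_measure, extZero_comp_coe]

lemma memLp_extZero (f : Curve) : MemLp (extZero f) 2 (volume : Measure ℝ) := by
  have h1 : MemLp (extZero f) 2 (volume.restrict I) := by
    rw [← unitInterval.measurePreserving_coe.map_eq,
      unitInterval.measurableEmbedding_coe.memLp_map_measure_iff, extZero_comp_coe]
    exact Lp.memLp f
  rw [← indicator_extZero]
  exact (memLp_indicator_iff_restrict measurableSet_Icc).2 h1

lemma ae_real_of_ae_unitInterval {p : I → Prop} (h : ∀ᵐ s : I, p s) :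
    ∀ᵐ x : ℝ, ∀ hx : x ∈ I, p ⟨x, hx⟩ := by
  have h1 : ∀ᵐ x ∂(volume.restrict I : Measure ℝ), ∀ hx : x ∈ I, p ⟨x, hx⟩ := by
    rw [← unitInterval.measurePreserving_coe.map_eq,
      unitInterval.measurableEmbedding_coe.ae_map_iff]
    filter_upwards [h] with s hs _
    exact hs
  filter_upwards [(ae_restrict_iff' measurableSet_Icc).1 h1] with x hx hxI
  exact hx hxI hxI

/-- Extension by zero as a map `L²[0,1] → L²(ℝ)`. -/
def extendL : Curve →L[ℝ] Lp ℝ 2 (volume : Measure ℝ) :=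
  LinearMap.mkContinuous
    { toFun := fun f => (memLp_extZero f).toLp _
      map_add' := fun f g => by
        rw [← MemLp.toLp_add]
        refine MemLp.toLp_congr _ _ ?_
        filter_upwards [ae_real_of_ae_unitInterval (Lp.coeFn_add f g)] with x hx
        by_cases hI : x ∈ I
        · simp only [Pi.add_apply, extZero, dif_pos hI]
          exact hx hI
        · simp only [Pi.add_apply, extZero, dif_neg hI, add_zero]
      map_smul' := fun r f => by
        rw [RingHom.id_apply, ← MemLp.toLp_const_smul]
        refine MemLp.toLp_congr _ _ ?_
        filter_upwards [ae_real_of_ae_unitInterval (Lp.coeFn_smul r f)] with x hx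
        by_cases hI : x ∈ I
        · simp only [Pi.smul_apply, extZero, dif_pos hI]
          exact hx hI
        · simp only [Pi.smul_apply, extZero, dif_neg hI, smul_zero] }
    1 fun f => by
      rw [one_mul, LinearMap.coe_mk, AddHom.coe_mk, Lp.norm_toLp, eLpNorm_extZero, Lp.norm_def]

/-- Restriction as a map `L²(ℝ) → L²[0,1]`. -/
def restrictL : Lp ℝ 2 (volume : Measure ℝ) →L[ℝ] Curve :=
  (Lp.compMeasurePreservingₗᵢ ℝ _ unitInterval.measurePreserving_coe).toContinuousLinearMap ∘L
    LpToLpRestrictCLM ℝ ℝ ℝ volume 2 I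

lemma coeFn_restrictL (g : Lp ℝ 2 (volume : Measure ℝ)) :
    restrictL g =ᵐ[volume] fun s : I => g s := by
  have h1 : restrictL g =ᵐ[volume] LpToLpRestrictCLM ℝ ℝ ℝ volume 2 I g ∘ ((↑) : I → ℝ) :=
    Lp.coeFn_compMeasurePreserving _ unitInterval.measurePreserving_coe
  have h2 := unitInterval.measurePreserving_coe.quasiMeasurePreserving.ae
    (LpToLpRestrictCLM_coeFn (p := 2) ℝ I g)
  filter_upwards [h1, h2] with s h3 h4
  rw [h3, Function.comp_apply, h4]

lemma norm_restrictL_le (g : Lp ℝ 2 (volume : Measure ℝ)) : ‖restrictL g‖ ≤ ‖g‖ := by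
  have h : ‖restrictL g‖ = ‖LpToLpRestrictCLM ℝ ℝ ℝ volume 2 I g‖ :=
    Lp.norm_compMeasurePreserving _ _
  rw [h]
  exact norm_Lp_toLp_restrict_le I g

/-- The shift as a bounded operator. -/
def shiftL (δ : ℝ) : Curve →L[ℝ] Curve :=
  restrictL ∘L (Lp.compMeasurePreservingₗᵢ ℝ _
    (measurePreserving_sub_right (volume : Measure ℝ) δ)).toContinuousLinearMap ∘L extendL

lemma shiftL_apply (δ : ℝ) (f : Curve) : shiftL δ f = shift δ f := by
  apply Lp.ext
  have h1 := coeFn_restrictL (Lp.compMeasurePreserving _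
    (measurePreserving_sub_right (volume : Measure ℝ) δ) (extendL f))
  have h2 : Lp.compMeasurePreserving _ (measurePreserving_sub_right (volume : Measure ℝ) δ)
      (extendL f) = ((memLp_extZero f).comp_measurePreserving
        (measurePreserving_sub_right (volume : Measure ℝ) δ)).toLp _ := rfl
  have h3 : ∀ᵐ s : I, Lp.compMeasurePreserving _
      (measurePreserving_sub_right (volume : Measure ℝ) δ) (extendL f) s
        = extZero f (s - δ) := by
    have := MemLp.coeFn_toLp ((memLp_extZero f).comp_measurePreserving
        (measurePreserving_sub_right (volume : Measure ℝ) δ))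
    rw [← h2] at this
    exact unitInterval.measurePreserving_coe.quasiMeasurePreserving.ae
      (ae_restrict_of_ae this)
  filter_upwards [h1, h3, (memLp_shift δ f).coeFn_toLp] with s h4 h5 h6
  rw [shift, h6, ← h5, ← h4]
  rfl

lemma norm_shiftL_le (δ : ℝ) : ‖shiftL δ‖ ≤ 1 := by
  refine ContinuousLinearMap.opNorm_le_bound _ zero_le_one fun f => ?_
  rw [one_mul]
  refine (norm_restrictL_le _).trans ?_
  refine (Lp.norm_compMeasurePreserving _ _).le.trans ?_
  refine (extendL.le_opNorm f).trans ?_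
  exact mul_le_of_le_one_left (norm_nonneg _) (LinearMap.mkContinuous_norm_le _ zero_le_one _)

/-- Continuity of translations in `L²(ℝ)`; it serves to reach the boundary case `δ = δstar`. -/
lemma continuous_shiftL_apply (f : Curve) : Continuous fun δ => shiftL δ f := by
  refine restrictL.continuous.comp ?_
  exact Continuous.compMeasurePreservingLp (f := fun _ : ℝ => extendL f)
    (g := fun δ : ℝ => (⟨fun x : ℝ => x - δ, by fun_prop⟩ : C(ℝ, ℝ))) continuous_const
    (ContinuousMap.continuous_of_continuous_uncurry _ (by
      simp only [Function.uncurry_def, ContinuousMap.coe_mk]; fun_prop))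
    (fun δ => measurePreserving_sub_right (volume : Measure ℝ) δ) (by norm_num)

end Shift

/-! ### Cut-offs to measurable subsets of the interval. -/

section Cut

lemma memLp_cut {J : Set I} (hJ : MeasurableSet J) (f : Curve) :
    MemLp (J.indicator (f : I → ℝ)) 2 volume := (Lp.memLp f).indicator hJ

/-- Multiplication by the indicator function of `J`. -/
def cut (J : Set I) (hJ : MeasurableSet J) : Curve →L[ℝ] Curve :=
  LinearMap.mkContinuous
    { toFun := fun f => (memLp_cut hJ f).toLp _
      map_add' := fun f g => by
        rw [← MemLp.toLp_add]
        refine MemLp.toLp_congr _ _ ?_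
        filter_upwards [Lp.coeFn_add f g] with x hx
        by_cases h : x ∈ J
        · simp only [Pi.add_apply, Set.indicator_of_mem h]
          exact hx
        · simp only [Pi.add_apply, Set.indicator_of_notMem h, add_zero]
      map_smul' := fun r f => by
        rw [RingHom.id_apply, ← MemLp.toLp_const_smul]
        refine MemLp.toLp_congr _ _ ?_
        filter_upwards [Lp.coeFn_smul r f] with x hx
        by_cases h : x ∈ J
        · simp only [Pi.smul_apply, Set.indicator_of_mem h]
          exact hx
        · simp only [Pi.smul_apply, Set.indicator_of_notMem h, smul_zero] }
    1 fun f => by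
      rw [one_mul, LinearMap.coe_mk, AddHom.coe_mk, Lp.norm_toLp, Lp.norm_def]
      exact ENNReal.toReal_mono (Lp.eLpNorm_ne_top _) (eLpNorm_indicator_le _)

lemma cut_apply (J : Set I) (hJ : MeasurableSet J) (f : Curve) :
    cut J hJ f = (memLp_cut hJ f).toLp _ := rfl

lemma coeFn_cut (J : Set I) (hJ : MeasurableSet J) (f : Curve) :
    cut J hJ f =ᵐ[volume] J.indicator f := by
  rw [cut_apply]
  exact (memLp_cut hJ f).coeFn_toLp

lemma norm_cut_le (J : Set I) (hJ : MeasurableSet J) : ‖cut J hJ‖ ≤ 1 :=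
  LinearMap.mkContinuous_norm_le _ zero_le_one _

lemma cut_cut (J : Set I) (hJ : MeasurableSet J) (f : Curve) :
    cut J hJ (cut J hJ f) = cut J hJ f := by
  apply Lp.ext
  filter_upwards [coeFn_cut J hJ f, coeFn_cut J hJ (cut J hJ f)] with s h1 h2
  by_cases h : s ∈ J <;> simp [h1, h2, h]

lemma adjoint_cut (J : Set I) (hJ : MeasurableSet J) :
    ContinuousLinearMap.adjoint (cut J hJ) = cut J hJ := by
  symm
  rw [ContinuousLinearMap.eq_adjoint_iff]
  intro f g
  rw [L2.inner_def, L2.inner_def]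
  refine integral_congr_ae ?_
  filter_upwards [coeFn_cut J hJ f, coeFn_cut J hJ g] with s h1 h2
  by_cases h : s ∈ J <;> simp [h1, h2, h]

lemma sum_cut_preimage {ι : Type*} [MeasurableSpace ι] [MeasurableSingletonClass ι] (S : Finset ι)
    {φ : I → ι} (hφ : Measurable φ) (hS : ∀ s, φ s ∈ S) (f : Curve) :
    ∑ m ∈ S, cut (φ ⁻¹' {m}) (hφ (measurableSet_singleton m)) f = f := by
  apply Lp.ext
  have h1 : ∀ᵐ s : I, ∀ m ∈ S, cut (φ ⁻¹' {m}) (hφ (measurableSet_singleton m)) f s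
      = (φ ⁻¹' {m}).indicator f s := by
    rw [eventually_all_finset]
    exact fun m _ => coeFn_cut _ _ f
  filter_upwards [h1, Lp.coeFn_finsetSum S fun m =>
    cut (φ ⁻¹' {m}) (hφ (measurableSet_singleton m)) f] with s h2 h3
  rw [h3, Finset.sum_apply, Finset.sum_congr rfl h2, Finset.sum_eq_single (φ s)]
  · simp
  · intro m _ hm
    simp [hm.symm]
  · intro h
    exact absurd (hS s) h

lemma shift_cut_eq_zero (δ : ℝ) (J : Set I) (hJ : MeasurableSet J) (f : Curve) :
    ∀ᵐ s : I, (∀ s' ∈ J, (s : ℝ) - δ ≠ s') → shift δ (cut J hJ f) s = 0 := by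
  have h := (measurePreserving_sub_right (volume : Measure ℝ) δ).quasiMeasurePreserving.ae
    (ae_real_of_ae_unitInterval (coeFn_cut J hJ f))
  have h' := unitInterval.measurePreserving_coe.quasiMeasurePreserving.ae (ae_restrict_of_ae h)
  filter_upwards [(memLp_shift δ (cut J hJ f)).coeFn_toLp, h'] with s h1 h2 h3
  rw [shift, h1, extZero]
  split_ifs with hs
  · rw [h2 hs, Set.indicator_of_notMem]
    exact fun hJs => h3 _ hJs rfl
  · rfl

end Cut

/-! ### Absolutely convergent series in extended norms. -/

section Enorm

variable {ι E : Type*} [NormedAddCommGroup E]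

lemma summable_of_tsum_enorm_ne_top [CompleteSpace E] {f : ι → E} (h : ∑' i, ‖f i‖ₑ ≠ ∞) :
    Summable f :=
  Summable.of_nnnorm (ENNReal.tsum_coe_ne_top_iff_summable.1 h)

lemma tsum_enorm_ne_top_of_summable {w : ι → ℝ} (h : Summable w) : ∑' i, ‖w i‖ₑ ≠ ∞ :=
  ENNReal.tsum_coe_ne_top_iff_summable.2 (NNReal.summable_coe.1 h.norm)

lemma enorm_le_tsum_enorm {f : ι → E} {a : E} (h : HasSum f a) : ‖a‖ₑ ≤ ∑' i, ‖f i‖ₑ := by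
  refine le_of_tendsto (h.enorm) (Eventually.of_forall fun s => ?_)
  exact (enorm_sum_le s f).trans (ENNReal.sum_le_tsum s)

lemma enorm_outer {α β : Type*} [MeasureSpace α] [MeasureSpace β]
    [SFinite (volume : Measure α)] [SFinite (volume : Measure β)] (x : L2 α) (y : L2 β) :
    ‖outer x y‖ₑ = ‖x‖ₑ * ‖y‖ₑ := by
  rw [← ofReal_norm, norm_outer, ENNReal.ofReal_mul (norm_nonneg _), ofReal_norm, ofReal_norm]

lemma enorm_inner_le {H : Type*} [NormedAddCommGroup H] [InnerProductSpace ℝ H] (x y : H) :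
    ‖(inner ℝ x y : ℝ)‖ₑ ≤ ‖x‖ₑ * ‖y‖ₑ := by
  rw [← ofReal_norm, ← ofReal_norm, ← ofReal_norm, ← ENNReal.ofReal_mul (norm_nonneg _)]
  exact ENNReal.ofReal_le_ofReal (norm_inner_le_norm x y)

end Enorm

/-! ## Coordinate swap -/

section Swap

/-- The swap `x(t, s) ↦ x(s, t)`. -/
def swapSurface : Surface →ₗᵢ[ℝ] Surface :=
  Lp.compMeasurePreservingₗᵢ ℝ _
    (Measure.measurePreserving_swap (μ := (volume : Measure I)) (ν := (volume : Measure I)))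

lemma measurePreserving_swap_swap :
    MeasurePreserving (Prod.map Prod.swap Prod.swap : (I × I) × (I × I) → (I × I) × (I × I))
      volume volume :=
  (Measure.measurePreserving_swap (μ := (volume : Measure I)) (ν := (volume : Measure I))).prod
    (Measure.measurePreserving_swap (μ := (volume : Measure I)) (ν := (volume : Measure I)))

/-- The swap `k((t, s), (t', s')) ↦ k((s, t), (s', t'))`. -/
def swapOp : SurfaceOp →ₗᵢ[ℝ] SurfaceOp :=
  Lp.compMeasurePreservingₗᵢ ℝ _ measurePreserving_swap_swap

lemma coeFn_swapSurface (x : Surface) : swapSurface x =ᵐ[volume] x ∘ Prod.swap :=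
  Lp.coeFn_compMeasurePreserving x _

lemma coeFn_swapOp (k : SurfaceOp) :
    swapOp k =ᵐ[volume] k ∘ Prod.map Prod.swap Prod.swap :=
  Lp.coeFn_compMeasurePreserving k measurePreserving_swap_swap

lemma swapOp_outer (x y : Surface) :
    swapOp (outer x y) = outer (swapSurface x) (swapSurface y) := by
  apply Lp.ext
  have h1 := measurePreserving_swap_swap.quasiMeasurePreserving.ae (coeFn_outer x y)
  have h2 := (Measure.quasiMeasurePreserving_fst (μ := (volume : Measure (I × I)))
    (ν := (volume : Measure (I × I)))).ae (coeFn_swapSurface x)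
  have h3 := (Measure.quasiMeasurePreserving_snd (μ := (volume : Measure (I × I)))
    (ν := (volume : Measure (I × I)))).ae (coeFn_swapSurface y)
  filter_upwards [coeFn_swapOp (outer x y), h1, h2, h3,
    coeFn_outer (swapSurface x) (swapSurface y)] with p h4 h5 h6 h7 h8
  rw [h4, h8, h6, h7, Function.comp_apply, h5]
  rfl

lemma swapOp_opTensor (a b : CurveOp) : swapOp (opTensor a b) = opTensor b a := by
  apply Lp.ext
  have h1 := measurePreserving_swap_swap.quasiMeasurePreserving.ae (coeFn_opTensor a b)
  filter_upwards [coeFn_swapOp (opTensor a b), h1, coeFn_opTensor b a] with p h4 h5 h6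
  rw [h4, h6, Function.comp_apply, h5, mul_comm]
  rfl

/-- Through the swap, every fact about the second shifted partial trace is inherited from the first.
-/
lemma contractFst_eq (c : CurveOp) (k : SurfaceOp) :
    contractFst c k = contractSnd c (swapOp k) := by
  refine ext_inner_right ℝ fun a => ?_
  rw [inner_contractFst, inner_contractSnd, ← swapOp_opTensor c a, LinearIsometry.inner_map_map]

lemma shiftedPartialTrace₂_eq (δ : ℝ) (k : SurfaceOp) :
    shiftedPartialTrace₂ δ k = shiftedPartialTrace₁ δ (swapOp k) := by
  simp only [shiftedPartialTrace₂, shiftedPartialTrace₁, contractFst_eq]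

lemma IsBanded.swapOp {δ : ℝ} {b : SurfaceOp} (h : IsBanded δ b) :
    IsBanded δ (swapOp b) := by
  have h1 := measurePreserving_swap_swap.quasiMeasurePreserving.ae h
  unfold IsBanded
  filter_upwards [h1, coeFn_swapOp b] with p h2 h3 h4
  rw [h3]
  refine h2 ?_
  rw [max_comm]
  exact h4

end Swap

/-! ## Nuclear sums of kernels -/

section Nuclear

/-- `k = ∑ᵢ xᵢ ⊗ yᵢ` with `∑ᵢ ‖xᵢ‖ ‖yᵢ‖ ≤ r`. -/
def HasNuclearSum (k : SurfaceOp) (r : ℝ≥0∞) : Prop :=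
  ∃ (ι : Type) (x y : ι → Surface), HasSum (fun i => outer (x i) (y i)) k ∧
    ∑' i, ‖x i‖ₑ * ‖y i‖ₑ ≤ r

lemma HasNuclearSum.swapOp {k : SurfaceOp} {r : ℝ≥0∞} (h : HasNuclearSum k r) :
    HasNuclearSum (swapOp k) r := by
  obtain ⟨ι, x, y, hk, hr⟩ := h
  refine ⟨ι, fun i => swapSurface (x i), fun i => swapSurface (y i), ?_, ?_⟩
  · simp_rw [← swapOp_outer]
    exact hk.mapL SepBand.swapOp.toContinuousLinearMap
  · simpa only [LinearIsometry.enorm_map] using hr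

lemma IsTraceClass.exists_hasNuclearSum {k : SurfaceOp} (h : IsTraceClass k) :
    ∃ r ≠ ∞, HasNuclearSum k r := by
  obtain ⟨w, e, f, hw, hs, he, hf, hk⟩ := h
  refine ⟨_, ?_, ℕ, fun j => w j • e j, f, ?_, le_rfl⟩
  · have : ∀ j, ‖w j • e j‖ₑ * ‖f j‖ₑ = ‖w j‖ₑ := fun j => by
      rw [enorm_smul, ← ofReal_norm (e j), ← ofReal_norm (f j), he.1, hf.1]
      simp
    simp_rw [this]
    exact tsum_enorm_ne_top_of_summable hs
  · simpa only [outer_smul_left] using hk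

lemma shiftedDiag_eq (δ : ℝ) (j : basisIndex) :
    shiftedDiag δ j = outer (basis j) (shiftL δ (basis j)) := by
  rw [shiftedDiag, shiftL_apply]

lemma tsum_enorm_sliceSnd_sq_le {V : Curve →L[ℝ] Curve} (hV : ‖V‖ ≤ 1) (x : Surface) :
    ∑' j, ‖sliceSnd (V (basis j)) x‖ₑ ^ 2 ≤ ‖x‖ₑ ^ 2 := by
  have h := tsum_enorm_inner_outer_map_sq_le basis basis (V := ContinuousLinearMap.id ℝ Curve)
    ContinuousLinearMap.norm_id_le hV x
  rw [ENNReal.tsum_prod' , ENNReal.tsum_comm] at h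
  refine le_trans (le_of_eq ?_) h
  simp_rw [← tsum_enorm_inner_sq basis, inner_sliceSnd]
  rfl

/-- Each term is a product of two slice norms; both families are square summable with the right
bound, so Cauchy-Schwarz applies. Summed over a nuclear decomposition, this bounds the partial
trace. -/
lemma tsum_enorm_contractSnd_outer_le (δ : ℝ) (x y : Surface) :
    ∑' j, ‖contractSnd (shiftedDiag δ j) (outer x y)‖ₑ ≤ ‖x‖ₑ * ‖y‖ₑ := by
  simp_rw [shiftedDiag_eq, contractSnd_outer_outer, enorm_outer]
  exact tsum_mul_le_of_sq_le
    (tsum_enorm_sliceSnd_sq_le (V := ContinuousLinearMap.id ℝ Curve)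
      ContinuousLinearMap.norm_id_le x)
    (tsum_enorm_sliceSnd_sq_le (norm_shiftL_le δ) y)

lemma HasNuclearSum.tsum_enorm_contractSnd_le {k : SurfaceOp} {r : ℝ≥0∞}
    (h : HasNuclearSum k r) (δ : ℝ) :
    ∑' j, ‖contractSnd (shiftedDiag δ j) k‖ₑ ≤ r := by
  obtain ⟨ι, x, y, hk, hr⟩ := h
  calc _ ≤ ∑' j, ∑' i, ‖contractSnd (shiftedDiag δ j) (outer (x i) (y i))‖ₑ := by
        gcongr with j
        exact enorm_le_tsum_enorm (hk.mapL _)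
    _ = ∑' i, ∑' j, ‖contractSnd (shiftedDiag δ j) (outer (x i) (y i))‖ₑ := ENNReal.tsum_comm
    _ ≤ ∑' i, ‖x i‖ₑ * ‖y i‖ₑ := by
        gcongr with i
        exact tsum_enorm_contractSnd_outer_le δ _ _
    _ ≤ r := hr

lemma HasNuclearSum.tsum_enorm_inner_le {k : SurfaceOp} {r : ℝ≥0∞}
    (h : HasNuclearSum k r) (δ : ℝ) :
    ∑' p : basisIndex × basisIndex,
      ‖(inner ℝ k (opTensor (shiftedDiag δ p.1) (shiftedDiag δ p.2)) : ℝ)‖ₑ ≤ r := by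
  obtain ⟨ι, x, y, hk, hr⟩ := h
  calc _ ≤ ∑' p : basisIndex × basisIndex, ∑' i, ‖(inner ℝ (outer (x i) (y i))
          (opTensor (shiftedDiag δ p.1) (shiftedDiag δ p.2)) : ℝ)‖ₑ := by
        gcongr with p
        simp_rw [real_inner_comm (opTensor _ _)]
        exact enorm_le_tsum_enorm
          (hk.mapL (innerSL ℝ (opTensor (shiftedDiag δ p.1) (shiftedDiag δ p.2))))
    _ = ∑' i, ∑' p : basisIndex × basisIndex, ‖(inner ℝ (outer (x i) (y i))
          (opTensor (shiftedDiag δ p.1) (shiftedDiag δ p.2)) : ℝ)‖ₑ := ENNReal.tsum_comm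
    _ ≤ ∑' i, ‖x i‖ₑ * ‖y i‖ₑ := by
        gcongr with i
        simp_rw [shiftedDiag_eq, opTensor_outer_outer, inner_outer_outer, enorm_mul]
        exact tsum_mul_le_of_sq_le
          (tsum_enorm_inner_outer_map_sq_le basis basis (V := ContinuousLinearMap.id ℝ Curve)
            (W := ContinuousLinearMap.id ℝ Curve) ContinuousLinearMap.norm_id_le
            ContinuousLinearMap.norm_id_le _)
          (tsum_enorm_inner_outer_map_sq_le basis basis (norm_shiftL_le δ) (norm_shiftL_le δ) _)
    _ ≤ r := hr

variable {k l : SurfaceOp} {r s : ℝ≥0∞}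

lemma HasNuclearSum.enorm_shiftedPartialTrace₁_le (h : HasNuclearSum k r) (δ : ℝ) :
    ‖shiftedPartialTrace₁ δ k‖ₑ ≤ r :=
  enorm_tsum_le_tsum_enorm.trans (h.tsum_enorm_contractSnd_le δ)

lemma HasNuclearSum.enorm_shiftedPartialTrace₂_le (h : HasNuclearSum k r) (δ : ℝ) :
    ‖shiftedPartialTrace₂ δ k‖ₑ ≤ r := by
  rw [shiftedPartialTrace₂_eq]
  exact h.swapOp.enorm_shiftedPartialTrace₁_le δ

lemma HasNuclearSum.enorm_shiftedTrace_le (h : HasNuclearSum k r) (δ : ℝ) :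
    ‖shiftedTrace δ k‖ₑ ≤ r :=
  enorm_tsum_le_tsum_enorm.trans (h.tsum_enorm_inner_le δ)

lemma HasNuclearSum.summable_contractSnd (h : HasNuclearSum k r) (hr : r ≠ ∞) (δ : ℝ) :
    Summable fun j => contractSnd (shiftedDiag δ j) k :=
  summable_of_tsum_enorm_ne_top ((h.tsum_enorm_contractSnd_le δ).trans_lt hr.lt_top).ne

lemma HasNuclearSum.summable_inner (h : HasNuclearSum k r) (hr : r ≠ ∞) (δ : ℝ) :
    Summable fun p : basisIndex × basisIndex =>
      (inner ℝ k (opTensor (shiftedDiag δ p.1) (shiftedDiag δ p.2)) : ℝ) :=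
  summable_of_tsum_enorm_ne_top ((h.tsum_enorm_inner_le δ).trans_lt hr.lt_top).ne

/-- Partial traces are unconditional sums, hence additive only where they converge; finite nuclear
cost supplies the convergence. -/
lemma HasNuclearSum.shiftedPartialTrace₁_add (hk : HasNuclearSum k r) (hr : r ≠ ∞)
    (hl : HasNuclearSum l s) (hs : s ≠ ∞) (δ : ℝ) : shiftedPartialTrace₁ δ (k + l) =
      shiftedPartialTrace₁ δ k + shiftedPartialTrace₁ δ l := by
  simp only [shiftedPartialTrace₁, map_add]
  exact (hk.summable_contractSnd hr δ).tsum_add (hl.summable_contractSnd hs δ)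

lemma HasNuclearSum.shiftedPartialTrace₂_add (hk : HasNuclearSum k r) (hr : r ≠ ∞)
    (hl : HasNuclearSum l s) (hs : s ≠ ∞) (δ : ℝ) : shiftedPartialTrace₂ δ (k + l) =
      shiftedPartialTrace₂ δ k + shiftedPartialTrace₂ δ l := by
  simp only [shiftedPartialTrace₂_eq, map_add]
  exact hk.swapOp.shiftedPartialTrace₁_add hr hl.swapOp hs δ

lemma HasNuclearSum.shiftedTrace_add (hk : HasNuclearSum k r) (hr : r ≠ ∞)
    (hl : HasNuclearSum l s) (hs : s ≠ ∞) (δ : ℝ) : shiftedTrace δ (k + l) =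
      shiftedTrace δ k + shiftedTrace δ l := by
  simp only [shiftedTrace, inner_add_left]
  exact (hk.summable_inner hr δ).tsum_add (hl.summable_inner hs δ)

end Nuclear

/-! ## Shifted traces of tensor products -/

section Model

/-- The shifted trace of an operator on `L²[0,1]`. -/
def curveTrace (δ : ℝ) (a : CurveOp) : ℝ := ∑' j, inner ℝ a (shiftedDiag δ j)

lemma IsTraceClass.summable_inner_shiftedDiag {a : CurveOp} (h : IsTraceClass a) (δ : ℝ) :
    Summable fun j => (inner ℝ a (shiftedDiag δ j) : ℝ) := by
  obtain ⟨w, e, f, hw, hs, he, hf, ha⟩ := h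
  refine summable_of_tsum_enorm_ne_top (ne_top_of_le_ne_top
    (tsum_enorm_ne_top_of_summable hs) ?_)
  calc _ ≤ ∑' j, ∑' i, ‖(inner ℝ (w i • outer (e i) (f i)) (shiftedDiag δ j) : ℝ)‖ₑ := by
        gcongr with j
        simp_rw [real_inner_comm (shiftedDiag δ j)]
        exact enorm_le_tsum_enorm (ha.mapL (innerSL ℝ (shiftedDiag δ j)))
    _ = ∑' i, ∑' j, ‖(inner ℝ (w i • outer (e i) (f i)) (shiftedDiag δ j) : ℝ)‖ₑ :=
        ENNReal.tsum_comm
    _ ≤ ∑' i, ‖w i‖ₑ := by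
        gcongr with i
        have h1 := tsum_enorm_inner_map_mul_inner_map_le basis
          (W := ContinuousLinearMap.id ℝ Curve) (V := shiftL δ) ContinuousLinearMap.norm_id_le
          (norm_shiftL_le δ) (e i) (f i)
        have h2 : ‖e i‖ₑ * ‖f i‖ₑ = 1 := by
          rw [← ofReal_norm (e i), ← ofReal_norm (f i), he.1, hf.1]
          simp
        rw [h2] at h1
        simp_rw [shiftedDiag_eq, inner_smul_left, inner_outer_outer, enorm_mul]
        rw [ENNReal.tsum_mul_left]
        refine (mul_le_mul_right h1 _).trans ?_
        simp

lemma hasSum_contractSnd_opTensor {a b : CurveOp} (hb : IsTraceClass b) (δ : ℝ) :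
    HasSum (fun j => contractSnd (shiftedDiag δ j) (opTensor a b)) (curveTrace δ b • a) := by
  simp_rw [contractSnd_opTensor]
  exact (hb.summable_inner_shiftedDiag δ).hasSum.smul_const a

lemma shiftedPartialTrace₁_opTensor_add {a b : CurveOp} (hb : IsTraceClass b) {l : SurfaceOp}
    {s : ℝ≥0∞} (hl : HasNuclearSum l s) (hs : s ≠ ∞) (δ : ℝ) :
    shiftedPartialTrace₁ δ (opTensor a b + l)
      = curveTrace δ b • a + shiftedPartialTrace₁ δ l := by
  have h := hasSum_contractSnd_opTensor (a := a) hb δ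
  simp only [shiftedPartialTrace₁, map_add]
  rw [h.summable.tsum_add (hl.summable_contractSnd hs δ), h.tsum_eq]

lemma shiftedPartialTrace₂_opTensor_add {a b : CurveOp} (ha : IsTraceClass a) {l : SurfaceOp}
    {s : ℝ≥0∞} (hl : HasNuclearSum l s) (hs : s ≠ ∞) (δ : ℝ) :
    shiftedPartialTrace₂ δ (opTensor a b + l)
      = curveTrace δ a • b + shiftedPartialTrace₂ δ l := by
  simp only [shiftedPartialTrace₂_eq, map_add, swapOp_opTensor]
  exact shiftedPartialTrace₁_opTensor_add ha hl.swapOp hs δ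

lemma shiftedTrace_opTensor_add {a b : CurveOp} (ha : IsTraceClass a) (hb : IsTraceClass b)
    {l : SurfaceOp} {s : ℝ≥0∞} (hl : HasNuclearSum l s) (hs : s ≠ ∞) (δ : ℝ) :
    shiftedTrace δ (opTensor a b + l)
      = curveTrace δ a * curveTrace δ b + shiftedTrace δ l := by
  have ha' := ha.summable_inner_shiftedDiag δ
  have hb' := hb.summable_inner_shiftedDiag δ
  have h : Summable fun p : basisIndex × basisIndex =>
      (inner ℝ a (shiftedDiag δ p.1) : ℝ) * inner ℝ b (shiftedDiag δ p.2) :=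
    summable_mul_of_summable_norm ha'.norm hb'.norm
  have h' := tsum_mul_tsum_of_summable_norm ha'.norm hb'.norm
  have hl' := hl.summable_inner hs δ
  rw [curveTrace, curveTrace, h', shiftedTrace, shiftedTrace, ← h.tsum_add hl']
  refine tsum_congr fun p => ?_
  rw [inner_add_left, inner_opTensor_opTensor]

end Model

/-! ## Shifted traces annihilate banded operators -/

section Banded

/-- The test kernel lives on `s ∈ J`, `s' - δ ∈ J`, and `hfar` places all such pairs outside the
band of `b`. -/
lemma inner_opTensor_cut_eq_zero {δstar δ : ℝ} {b : SurfaceOp} (hb : IsBanded δstar b)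
    {J : Set I} (hJ : MeasurableSet J)
    (hfar : ∀ s ∈ J, ∀ s' : I, (∃ s'' ∈ J, (s' : ℝ) - δ = s'') → δstar ≤ |(s : ℝ) - s'|)
    (u v f g : Curve) :
    (inner ℝ b (opTensor (outer u v) (outer (cut J hJ f) (shift δ (cut J hJ g)))) : ℝ) = 0 := by
  rw [L2.inner_def]
  refine integral_eq_zero_of_ae ?_
  have h1 : ∀ᵐ p : (I × I) × (I × I), outer (cut J hJ f) (shift δ (cut J hJ g)) (p.1.2, p.2.2)
      = cut J hJ f p.1.2 * shift δ (cut J hJ g) p.2.2 :=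
    (Measure.quasiMeasurePreserving_snd.comp
      measurePreserving_regroup.quasiMeasurePreserving).ae (coeFn_outer _ _)
  have h2 : ∀ᵐ p : (I × I) × (I × I), cut J hJ f p.1.2 = J.indicator f p.1.2 :=
    (Measure.quasiMeasurePreserving_snd.comp Measure.quasiMeasurePreserving_fst).ae
      (coeFn_cut J hJ f)
  have h3 : ∀ᵐ p : (I × I) × (I × I), (∀ s' ∈ J, (p.2.2 : ℝ) - δ ≠ s') →
      shift δ (cut J hJ g) p.2.2 = 0 :=
    (Measure.quasiMeasurePreserving_snd.comp Measure.quasiMeasurePreserving_snd).ae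
      (shift_cut_eq_zero δ J hJ g)
  filter_upwards [coeFn_opTensor (outer u v) (outer (cut J hJ f) (shift δ (cut J hJ g))),
    h1, h2, h3, hb] with p h4 h5 h6 h7 h8
  rw [h4, h5, h6]
  by_cases hp : p.1.2 ∈ J
  · by_cases hp' : ∃ s'' ∈ J, (p.2.2 : ℝ) - δ = s''
    · rw [h8 ((hfar _ hp _ hp').trans (le_max_right _ _))]
      simp
    · push Not at hp'
      rw [h7 hp']
      simp
  · simp [hp]

variable {ι : Type} {x y : ι → Surface} {k : SurfaceOp}

lemma enorm_sliceFst_le (u : Curve) (x : Surface) : ‖sliceFst u x‖ₑ ≤ ‖u‖ₑ * ‖x‖ₑ := by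
  rw [← ofReal_norm, ← ofReal_norm, ← ofReal_norm, ← ENNReal.ofReal_mul (norm_nonneg _)]
  exact ENNReal.ofReal_le_ofReal (norm_sliceFst_le u x)

lemma tsum_enorm_sliceFst_ne_top (h : ∑' i, ‖x i‖ₑ * ‖y i‖ₑ ≠ ∞) (u v : Curve) :
    ∑' i, ‖sliceFst u (x i)‖ₑ * ‖sliceFst v (y i)‖ₑ ≠ ∞ := by
  refine ne_top_of_le_ne_top (b := ∑' i, (‖u‖ₑ * ‖v‖ₑ) * (‖x i‖ₑ * ‖y i‖ₑ)) ?_ ?_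
  · rw [ENNReal.tsum_mul_left]
    exact ENNReal.mul_ne_top (ENNReal.mul_ne_top enorm_ne_top enorm_ne_top) h
  · refine ENNReal.tsum_le_tsum fun i => ?_
    rw [mul_mul_mul_comm]
    exact mul_le_mul' (enorm_sliceFst_le _ _) (enorm_sliceFst_le _ _)

/-- Expand `k`, exchange the two sums by absolute convergence, and apply Parseval for each `i`. Only
the product of `V` with the adjoint of `W` survives, so different choices of `W` and `V` express the
same trace. -/
lemma tsum_inner_opTensor_eq (hk : HasSum (fun i => outer (x i) (y i)) k)
    (h : ∑' i, ‖x i‖ₑ * ‖y i‖ₑ ≠ ∞) {W V : Curve →L[ℝ] Curve} (hW : ‖W‖ ≤ 1) (hV : ‖V‖ ≤ 1)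
    (u v : Curve) :
    ∑' j, (inner ℝ k (opTensor (outer u v) (outer (W (basis j)) (V (basis j)))) : ℝ) =
      ∑' i, inner ℝ (V (ContinuousLinearMap.adjoint W (sliceFst u (x i)))) (sliceFst v (y i)) := by
  set F : basisIndex → ι → ℝ := fun j i =>
    inner ℝ (sliceFst u (x i)) (W (basis j)) * inner ℝ (sliceFst v (y i)) (V (basis j)) with hF
  have hsum : Summable (Function.uncurry F) := by
    refine summable_of_tsum_enorm_ne_top (ne_top_of_le_ne_top
      (tsum_enorm_sliceFst_ne_top h u v) ?_)
    rw [ENNReal.tsum_prod', ENNReal.tsum_comm]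
    gcongr with i
    simp_rw [Function.uncurry_apply_pair, hF, enorm_mul]
    exact tsum_enorm_inner_map_mul_inner_map_le basis hW hV _ _
  calc _ = ∑' j, ∑' i, F j i := by
        refine tsum_congr fun j => ?_
        have := hk.mapL (innerSL ℝ (opTensor (outer u v) (outer (W (basis j)) (V (basis j)))))
        simp only [innerSL_apply_apply] at this
        rw [real_inner_comm, ← this.tsum_eq]
        refine tsum_congr fun i => ?_
        rw [real_inner_comm, opTensor_outer_outer, inner_outer_outer, hF]
        simp only [inner_sliceFst]
    _ = ∑' i, ∑' j, F j i := hsum.tsum_comm.symm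
    _ = _ := tsum_congr fun i => (hasSum_inner_map_mul_inner_map basis W V _ _).tsum_eq

/-- The room `δ - δstar` permits a partition into cells so short that each one, paired with its
translate by `δ`, stays off the band. Every cell contributes zero, and the cells add up to the full
trace. -/
lemma tsum_inner_shiftL_eq_zero_of_lt (hk : HasSum (fun i => outer (x i) (y i)) k)
    (h : ∑' i, ‖x i‖ₑ * ‖y i‖ₑ ≠ ∞) {δstar δ : ℝ} (hb : IsBanded δstar k) (hδ : δstar < δ)
    (u v : Curve) :
    ∑' i, (inner ℝ (shiftL δ (sliceFst u (x i))) (sliceFst v (y i)) : ℝ) = 0 := by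
  obtain ⟨n, hn⟩ := exists_nat_one_div_lt (sub_pos.2 hδ)
  set φ : I → ℕ := fun s => ⌊((n : ℝ) + 1) * s⌋₊ with hφ
  have hφm : Measurable φ := Nat.measurable_floor.comp (by fun_prop)
  have hJ : ∀ m, MeasurableSet (φ ⁻¹' {m}) := fun m => hφm (measurableSet_singleton m)
  -- The endpoint `s = 1` has label `n + 1`, hence `n + 2` cells.
  have hφS : ∀ s, φ s ∈ Finset.range (n + 2) := fun s => by
    rw [Finset.mem_range, hφ, Nat.lt_succ_iff]
    refine Nat.floor_le_of_le ?_
    push_cast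
    exact mul_le_of_le_one_right (by positivity) s.2.2
  have hpiece : ∀ m, ∑' i, (inner ℝ (shiftL δ (cut _ (hJ m) (sliceFst u (x i))))
      (sliceFst v (y i)) : ℝ) = 0 := by
    intro m
    have hV : ‖shiftL δ ∘L cut _ (hJ m)‖ ≤ 1 :=
      (ContinuousLinearMap.opNorm_comp_le _ _).trans
        (mul_le_one₀ (norm_shiftL_le δ) (norm_nonneg _) (norm_cut_le _ _))
    -- A cut-off is self-adjoint and idempotent, so placing it on both factors yields a single
    -- cut-off on the basis-free side.
    have h1 := tsum_inner_opTensor_eq hk h (norm_cut_le _ (hJ m)) hV u v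
    simp only [adjoint_cut, ContinuousLinearMap.comp_apply, cut_cut] at h1
    rw [← h1]
    refine (tsum_congr fun j => ?_).trans tsum_zero
    rw [shiftL_apply]
    refine inner_opTensor_cut_eq_zero hb (hJ m) ?_ u v _ _
    rintro s hs s' ⟨t, ht, hst⟩
    have hn0 : (0 : ℝ) < n + 1 := by positivity
    have h2 : ((n : ℝ) + 1) * s < ((n : ℝ) + 1) * t + 1 := by
      have h3 := Nat.lt_floor_add_one (((n : ℝ) + 1) * s)
      have h4 := Nat.floor_le (mul_nonneg hn0.le t.2.1)
      rw [Set.mem_preimage, Set.mem_singleton_iff] at hs ht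
      have h5 : (⌊((n : ℝ) + 1) * s⌋₊ : ℝ) = ⌊((n : ℝ) + 1) * t⌋₊ := by
        exact congrArg Nat.cast (hs.trans ht.symm)
      linarith
    have h3 : (s : ℝ) < t + 1 / (n + 1) := by
      rw [← mul_lt_mul_iff_right₀ hn0, mul_add, mul_one_div_cancel hn0.ne']
      exact h2
    rw [abs_sub_comm]
    refine le_trans ?_ (le_abs_self _)
    linarith
  have hsum : ∀ m ∈ Finset.range (n + 2), Summable fun i =>
      (inner ℝ (shiftL δ (cut _ (hJ m) (sliceFst u (x i)))) (sliceFst v (y i)) : ℝ) := by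
    intro m _
    refine summable_of_tsum_enorm_ne_top (ne_top_of_le_ne_top
      (tsum_enorm_sliceFst_ne_top h u v) ?_)
    gcongr with i
    refine (enorm_inner_le _ _).trans ?_
    gcongr
    rw [enorm_le_iff_norm_le]
    refine ((shiftL δ).le_of_opNorm_le (norm_shiftL_le δ) _).trans ?_
    rw [one_mul]
    refine ((cut _ (hJ m)).le_of_opNorm_le (norm_cut_le _ _) _).trans ?_
    rw [one_mul]
  calc _ = ∑' i, ∑ m ∈ Finset.range (n + 2),
        (inner ℝ (shiftL δ (cut _ (hJ m) (sliceFst u (x i)))) (sliceFst v (y i)) : ℝ) := by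
        refine tsum_congr fun i => ?_
        rw [← sum_inner, ← map_sum, sum_cut_preimage _ hφm hφS]
    _ = ∑ m ∈ Finset.range (n + 2), ∑' i,
        (inner ℝ (shiftL δ (cut _ (hJ m) (sliceFst u (x i)))) (sliceFst v (y i)) : ℝ) :=
        Summable.tsum_finsetSum hsum
    _ = 0 := Finset.sum_eq_zero fun m _ => hpiece m

/-- The series is dominated uniformly in `δ`, hence continuous in `δ`; it vanishes on the open
half-line and so on its closure. -/
lemma tsum_inner_shiftL_eq_zero (hk : HasSum (fun i => outer (x i) (y i)) k)
    (h : ∑' i, ‖x i‖ₑ * ‖y i‖ₑ ≠ ∞) {δstar δ : ℝ} (hb : IsBanded δstar k) (hδ : δstar ≤ δ)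
    (u v : Curve) :
    ∑' i, (inner ℝ (shiftL δ (sliceFst u (x i))) (sliceFst v (y i)) : ℝ) = 0 := by
  have hcont : Continuous fun δ =>
      ∑' i, (inner ℝ (shiftL δ (sliceFst u (x i))) (sliceFst v (y i)) : ℝ) := by
    refine continuous_tsum (u := fun i => ‖sliceFst u (x i)‖ * ‖sliceFst v (y i)‖)
      (fun i => (continuous_shiftL_apply _).inner continuous_const) ?_ fun i δ => ?_
    · refine summable_of_tsum_enorm_ne_top ?_
      simpa only [enorm_mul, enorm_norm] using tsum_enorm_sliceFst_ne_top h u v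
    · refine (norm_inner_le_norm _ _).trans ?_
      gcongr
      refine ((shiftL δ).le_of_opNorm_le (norm_shiftL_le δ) _).trans ?_
      rw [one_mul]
  have heq : Set.EqOn (fun δ =>
      ∑' i, (inner ℝ (shiftL δ (sliceFst u (x i))) (sliceFst v (y i)) : ℝ)) (fun _ => 0)
      (Set.Ioi δstar) := fun δ hδ => tsum_inner_shiftL_eq_zero_of_lt hk h hb hδ u v
  have := heq.closure hcont continuous_const
  rw [closure_Ioi] at this
  exact this hδ

variable {r : ℝ≥0∞} {δstar δ : ℝ}

lemma IsBanded.shiftedPartialTrace₁_eq_zero (hb : IsBanded δstar k) (h : HasNuclearSum k r)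
    (hr : r ≠ ∞) (hδ : δstar ≤ δ) : shiftedPartialTrace₁ δ k = 0 := by
  refine eq_zero_of_inner_outer_eq_zero fun u v => ?_
  have h1 := (h.summable_contractSnd hr δ).hasSum.mapL (innerSL ℝ (outer u v))
  simp only [innerSL_apply_apply] at h1
  obtain ⟨ι, x, y, hk, hxy⟩ := h
  rw [shiftedPartialTrace₁, real_inner_comm, ← h1.tsum_eq]
  have h2 := tsum_inner_opTensor_eq hk (ne_top_of_le_ne_top hr hxy)
    (W := ContinuousLinearMap.id ℝ Curve) ContinuousLinearMap.norm_id_le (norm_shiftL_le δ) u v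
  simp_rw [real_inner_comm _ (outer u v), inner_contractSnd, shiftedDiag_eq]
  refine h2.trans ?_
  rw [ContinuousLinearMap.adjoint_id]
  exact tsum_inner_shiftL_eq_zero hk (ne_top_of_le_ne_top hr hxy) hb hδ u v

lemma IsBanded.shiftedPartialTrace₂_eq_zero (hb : IsBanded δstar k) (h : HasNuclearSum k r)
    (hr : r ≠ ∞) (hδ : δstar ≤ δ) : shiftedPartialTrace₂ δ k = 0 := by
  rw [shiftedPartialTrace₂_eq]
  exact hb.swapOp.shiftedPartialTrace₁_eq_zero h.swapOp hr hδ

/-- The full trace is the iterated one: summing over the second index first produces the partial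
trace, which is already zero. -/
lemma IsBanded.shiftedTrace_eq_zero (hb : IsBanded δstar k) (h : HasNuclearSum k r)
    (hr : r ≠ ∞) (hδ : δstar ≤ δ) : shiftedTrace δ k = 0 := by
  have h1 := h.summable_inner hr δ
  rw [shiftedTrace, h1.tsum_prod]
  refine (tsum_congr fun i => ?_).trans tsum_zero
  have h2 := (h.summable_contractSnd hr δ).hasSum.mapL (innerSL ℝ (shiftedDiag δ i))
  simp only [innerSL_apply_apply] at h2
  have h3 : ∑' j, contractSnd (shiftedDiag δ j) k = 0 := hb.shiftedPartialTrace₁_eq_zero h hr hδ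
  rw [h3, inner_zero_right] at h2
  simp_rw [real_inner_comm _ (shiftedDiag δ i), inner_contractSnd] at h2
  exact h2.tsum_eq

/-- With `k` annihilated, the three traces are `tr(b) a`, `tr(a) b` and `tr(a) tr(b)`, with shifted
traces throughout. The scalars cancel because `htr` makes both nonzero. -/
lemma separablePart_opTensor_add {a b : CurveOp} (ha : IsTraceClass a) (hb : IsTraceClass b)
    (hk : IsTraceClass k) (hband : IsBanded δstar k) (hδ : δstar ≤ δ)
    (htr : shiftedTrace δ (opTensor a b + k) ≠ 0) :
    separablePart δ (opTensor a b + k) = opTensor a b := by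
  obtain ⟨r, hr, h⟩ := hk.exists_hasNuclearSum
  rw [shiftedTrace_opTensor_add ha hb h hr, hband.shiftedTrace_eq_zero h hr hδ, add_zero] at htr
  rw [separablePart, shiftedPartialTrace₁_opTensor_add hb h hr,
    shiftedPartialTrace₂_opTensor_add ha h hr, shiftedTrace_opTensor_add ha hb h hr,
    hband.shiftedTrace_eq_zero h hr hδ, hband.shiftedPartialTrace₁_eq_zero h hr hδ,
    hband.shiftedPartialTrace₂_eq_zero h hr hδ, add_zero, add_zero, add_zero]
  simp only [← opTensorL_apply, map_smul, smul_apply, smul_smul]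
  have hta := left_ne_zero_of_mul htr
  have htb := right_ne_zero_of_mul htr
  convert one_smul ℝ _
  field_simp

lemma toeplitzAvg_of_mem {b : SurfaceOp} (hb : b ∈ stationary) : toeplitzAvg b = b :=
  Submodule.starProjection_eq_self_iff.2 (stationary.le_topologicalClosure hb)

end Banded

/-! ## Absolute coefficient sums in an orthonormal basis -/

section CoeffNorm

variable (e : HilbertBasis ℕ ℝ Surface)

/-- The absolute sum of the coefficients of a surface in the basis `e`. -/
def l1Norm (x : Surface) : ℝ≥0∞ := ∑' j, ‖(inner ℝ x (e j) : ℝ)‖ₑ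

/-- The absolute sum of the coefficients of a kernel in the basis `eᵢ ⊗ eⱼ`. -/
def coeffNorm (k : SurfaceOp) : ℝ≥0∞ :=
  ∑' p : ℕ × ℕ, ‖(inner ℝ k (outer (e p.1) (e p.2)) : ℝ)‖ₑ

lemma l1Norm_add_le (x y : Surface) : l1Norm e (x + y) ≤ l1Norm e x + l1Norm e y := by
  rw [l1Norm, l1Norm, l1Norm, ← ENNReal.tsum_add]
  gcongr with j
  rw [inner_add_left]
  exact enorm_add_le _ _

lemma l1Norm_smul (r : ℝ) (x : Surface) : l1Norm e (r • x) = ‖r‖ₑ * l1Norm e x := by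
  rw [l1Norm, l1Norm, ← ENNReal.tsum_mul_left]
  simp_rw [inner_smul_left, enorm_mul]
  rfl

lemma l1Norm_neg (x : Surface) : l1Norm e (-x) = l1Norm e x := by
  rw [← neg_one_smul ℝ x, l1Norm_smul]
  simp

lemma l1Norm_sub_le (x y : Surface) : l1Norm e (x - y) ≤ l1Norm e x + l1Norm e y := by
  rw [sub_eq_add_neg, ← l1Norm_neg e y]
  exact l1Norm_add_le e _ _

lemma coeffNorm_add_le (k l : SurfaceOp) :
    coeffNorm e (k + l) ≤ coeffNorm e k + coeffNorm e l := by
  rw [coeffNorm, coeffNorm, coeffNorm, ← ENNReal.tsum_add]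
  gcongr with j
  rw [inner_add_left]
  exact enorm_add_le _ _

lemma coeffNorm_smul (r : ℝ) (k : SurfaceOp) :
    coeffNorm e (r • k) = ‖r‖ₑ * coeffNorm e k := by
  rw [coeffNorm, coeffNorm, ← ENNReal.tsum_mul_left]
  simp_rw [inner_smul_left, enorm_mul]
  rfl

lemma coeffNorm_neg (k : SurfaceOp) : coeffNorm e (-k) = coeffNorm e k := by
  rw [← neg_one_smul ℝ k, coeffNorm_smul]
  simp

lemma coeffNorm_sub_le (k l : SurfaceOp) :
    coeffNorm e (k - l) ≤ coeffNorm e k + coeffNorm e l := by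
  rw [sub_eq_add_neg, ← coeffNorm_neg e l]
  exact coeffNorm_add_le e _ _

lemma coeffNorm_outer (x y : Surface) : coeffNorm e (outer x y) = l1Norm e x * l1Norm e y := by
  rw [coeffNorm, ENNReal.tsum_prod', l1Norm, l1Norm, ← ENNReal.tsum_mul_right]
  simp_rw [← ENNReal.tsum_mul_left, inner_outer_outer, enorm_mul]

lemma hasSum_coeff (k : SurfaceOp) : HasSum (fun p : ℕ × ℕ =>
    outer ((inner ℝ k (outer (e p.1) (e p.2)) : ℝ) • e p.1) (e p.2)) k := by
  have h := (outerBasis e e).hasSum_repr k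
  simp_rw [HilbertBasis.repr_apply_apply, outerBasis_apply, ← outer_smul_left,
    real_inner_comm k] at h
  exact h

lemma HilbertBasis.enorm_eq_one {ι H : Type*} [NormedAddCommGroup H] [InnerProductSpace ℝ H]
    (b : HilbertBasis ι ℝ H) (i : ι) : ‖b i‖ₑ = 1 := by
  rw [← ofReal_norm, b.orthonormal.1]
  simp

/-- The expansion in `eᵢ ⊗ eⱼ` is itself a sum of rank-one kernels. This is the bridge from
coefficients, where probability is easy, to traces. -/
lemma hasNuclearSum_coeffNorm (k : SurfaceOp) : HasNuclearSum k (coeffNorm e k) := by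
  refine ⟨ℕ × ℕ, _, _, hasSum_coeff e k, ?_⟩
  simp_rw [enorm_smul, HilbertBasis.enorm_eq_one, mul_one]
  exact le_rfl

lemma enorm_le_coeffNorm (k : SurfaceOp) : ‖k‖ₑ ≤ coeffNorm e k := by
  refine (enorm_le_tsum_enorm (hasSum_coeff e k)).trans ?_
  simp_rw [enorm_outer, enorm_smul, HilbertBasis.enorm_eq_one, mul_one]
  exact le_rfl

lemma norm_le_of_coeffNorm_le {k : SurfaceOp} {r : ℝ} (hr : 0 ≤ r)
    (h : coeffNorm e k ≤ ENNReal.ofReal r) : ‖k‖ ≤ r := by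
  rw [← ENNReal.ofReal_le_ofReal_iff hr, ofReal_norm]
  exact (enorm_le_coeffNorm e k).trans h

lemma enorm_le_l1Norm (x : Surface) : ‖x‖ₑ ≤ l1Norm e x := by
  refine (enorm_le_tsum_enorm (e.hasSum_repr x)).trans ?_
  simp_rw [enorm_smul, HilbertBasis.enorm_eq_one, mul_one, HilbertBasis.repr_apply_apply,
    real_inner_comm x]
  exact le_rfl

/-- The left side is the trace, a sum of nonnegative diagonal coefficients. -/
lemma sum_enorm_sq_le_coeffNorm (x : ℕ → Surface) (S : Finset ℕ) :
    ∑ n ∈ S, ‖x n‖ₑ ^ 2 ≤ coeffNorm e (∑ n ∈ S, outer (x n) (x n)) := by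
  simp_rw [← tsum_enorm_inner_sq e]
  rw [← Summable.tsum_finsetSum fun _ _ => ENNReal.summable]
  have h : ∀ j, ∑ n ∈ S, ‖(inner ℝ (x n) (e j) : ℝ)‖ₑ ^ 2
      = ‖(inner ℝ (∑ n ∈ S, outer (x n) (x n)) (outer (e j) (e j)) : ℝ)‖ₑ := by
    intro j
    rw [sum_inner]
    simp_rw [inner_outer_outer, ← pow_two]
    rw [Real.enorm_of_nonneg (Finset.sum_nonneg fun _ _ => sq_nonneg _),
      ENNReal.ofReal_sum_of_nonneg fun _ _ => sq_nonneg _]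
    refine Finset.sum_congr rfl fun n _ => ?_
    rw [← Real.enorm_of_nonneg (sq_nonneg _), enorm_pow]
  simp_rw [h]
  rw [coeffNorm, ENNReal.tsum_prod']
  gcongr with j
  exact ENNReal.le_tsum (f := fun l =>
    ‖(inner ℝ (∑ n ∈ S, outer (x n) (x n)) (outer (e j) (e l)) : ℝ)‖ₑ) j

end CoeffNorm

/-! ## Local Lipschitz continuity of the estimators -/

section Lipschitz

variable (e : HilbertBasis ℕ ℝ Surface) {c : SurfaceOp}

/-- The map `(a, t, b) ↦ a ⊗̃ t⁻¹ b` is differentiable where `t ≠ 0`, hence Lipschitz at the given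
point. -/
lemma exists_norm_opTensor_sub_le (a b : CurveOp) {t : ℝ} (ht : t ≠ 0) :
    ∃ K, 0 < K ∧ ∀ a' b' : CurveOp, ∀ t' r : ℝ, K * r ≤ 1 → ‖a' - a‖ ≤ r → ‖b' - b‖ ≤ r →
      ‖t' - t‖ ≤ r → ‖opTensor a' (t'⁻¹ • b') - opTensor a (t⁻¹ • b)‖ ≤ K * r := by
  set f : CurveOp × ℝ × CurveOp → SurfaceOp := fun p => opTensorL p.1 (p.2.1⁻¹ • p.2.2) with hf
  have hd : DifferentiableAt ℝ f (a, t, b) := by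
    have h0 : DifferentiableAt ℝ (fun p : CurveOp × ℝ × CurveOp => p.2.1) (a, t, b) := by
      fun_prop
    have h1 : DifferentiableAt ℝ (fun p : CurveOp × ℝ × CurveOp => p.2.1⁻¹ • p.2.2)
        (a, t, b) := (h0.fun_inv ht).smul (by fun_prop)
    have h2 : DifferentiableAt ℝ (fun p : CurveOp × ℝ × CurveOp => opTensorL p.1)
        (a, t, b) := by fun_prop
    exact h2.clm_apply h1
  obtain ⟨C, hC, h⟩ := hd.isBigO_sub.exists_pos
  obtain ⟨η, hη, h⟩ := Metric.eventually_nhds_iff.1 h.bound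
  -- The term `2 / η` lets the single condition `K * r ≤ 1` also force `r < η`, inside the
  -- neighbourhood where the bound holds.
  refine ⟨C + 2 / η, by positivity, fun a' b' t' r hr ha hb ht' => ?_⟩
  have hr0 : 0 ≤ r := (norm_nonneg _).trans ha
  have hn : ‖((a', t', b') : CurveOp × ℝ × CurveOp) - (a, t, b)‖ ≤ r := by
    simp only [Prod.mk_sub_mk, Prod.norm_mk, sup_le_iff]
    exact ⟨ha, ht', hb⟩
  have hrη : r < η := by
    have h1 : 2 / η * r ≤ 1 := le_trans (by nlinarith) hr
    rw [div_mul_eq_mul_div, div_le_one hη] at h1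
    linarith
  have := h (y := (a', t', b')) (by rw [dist_eq_norm]; exact hn.trans_lt hrη)
  refine this.trans ((mul_le_mul_of_nonneg_left hn hC.le).trans ?_)
  have : 0 ≤ 2 / η * r := by positivity
  linarith

lemma exists_norm_separablePart_sub_le (hc : coeffNorm e c ≠ ∞) {δ : ℝ}
    (ht : shiftedTrace δ c ≠ 0) :
    ∃ K, 0 < K ∧ ∀ (k : SurfaceOp) (r : ℝ), 0 ≤ r → K * r ≤ 1 →
      coeffNorm e (k - c) ≤ ENNReal.ofReal r →
      ‖separablePart δ k - separablePart δ c‖ ≤ K * r := by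
  obtain ⟨K, hK, h⟩ := exists_norm_opTensor_sub_le (shiftedPartialTrace₁ δ c)
    (shiftedPartialTrace₂ δ c) ht
  refine ⟨K, hK, fun k r hr0 hr hk => ?_⟩
  have hcn := hasNuclearSum_coeffNorm e c
  have hkn := hasNuclearSum_coeffNorm e (k - c)
  have hkt : coeffNorm e (k - c) ≠ ∞ := ne_top_of_le_ne_top ENNReal.ofReal_ne_top hk
  have hreal : ∀ {E : Type} [NormedAddCommGroup E] (v : E), ‖v‖ₑ ≤ coeffNorm e (k - c) →
      ‖v‖ ≤ r := fun v hv => by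
    rw [← ENNReal.ofReal_le_ofReal_iff hr0, ofReal_norm]
    exact hv.trans hk
  have h1 := hcn.shiftedPartialTrace₁_add hc hkn hkt δ
  have h2 := hcn.shiftedPartialTrace₂_add hc hkn hkt δ
  have h3 := hcn.shiftedTrace_add hc hkn hkt δ
  rw [add_sub_cancel] at h1 h2 h3
  refine h _ _ _ _ hr ?_ ?_ ?_
  · rw [h1, add_sub_cancel_left]
    exact hreal _ (hkn.enorm_shiftedPartialTrace₁_le δ)
  · rw [h2, add_sub_cancel_left]
    exact hreal _ (hkn.enorm_shiftedPartialTrace₂_le δ)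
  · rw [h3, add_sub_cancel_left]
    exact hreal _ (hkn.enorm_shiftedTrace_le δ)

lemma norm_toeplitzAvg_le (k : SurfaceOp) : ‖toeplitzAvg k‖ ≤ ‖k‖ :=
  (toeplitzAvg.le_of_opNorm_le (Submodule.starProjection_norm_le _) k).trans (one_mul _).le

lemma norm_bandedPart_sub_le (δ : ℝ) (k c : SurfaceOp) :
    ‖bandedPart δ k - bandedPart δ c‖ ≤ ‖k - c‖ + ‖separablePart δ k - separablePart δ c‖ := by
  rw [bandedPart, bandedPart, ← map_sub]
  refine (norm_toeplitzAvg_le _).trans ?_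
  rw [sub_sub_sub_comm]
  exact norm_sub_le _ _

lemma norm_proxy_sub_le (δ : ℝ) (k c : SurfaceOp) :
    ‖proxy δ k - proxy δ c‖ ≤ ‖k - c‖ + 2 * ‖separablePart δ k - separablePart δ c‖ := by
  rw [proxy, proxy, add_sub_add_comm]
  linarith [norm_add_le (separablePart δ k - separablePart δ c)
    (bandedPart δ k - bandedPart δ c), norm_bandedPart_sub_le δ k c]

end Lipschitz

/-! ## Empirical covariances -/

section EmpCov

variable (e : HilbertBasis ℕ ℝ Surface) {c : SurfaceOp}

/-- The raw second moment of the surfaces `xₙ`, `n ∈ S`. -/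
def secondMoment (x : ℕ → Surface) (S : Finset ℕ) : SurfaceOp :=
  (S.card : ℝ)⁻¹ • ∑ n ∈ S, outer (x n) (x n)

lemma empCov_eq (x : ℕ → Surface) (S : Finset ℕ) :
    empCov x S = secondMoment x S - outer (sampleMean x S) (sampleMean x S) := by
  rcases S.eq_empty_or_nonempty with rfl | hS
  · have : outer (0 : Surface) (0 : Surface) = 0 := by rw [← outerL_apply, map_zero]
    simp [empCov, secondMoment, sampleMean, this]
  have hc : (S.card : ℝ) ≠ 0 := by exact_mod_cast hS.card_pos.ne'
  have hm : ∑ n ∈ S, x n = (S.card : ℝ) • sampleMean x S := by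
    rw [sampleMean, smul_inv_smul₀ hc]
  simp only [empCov, secondMoment, ← outerL_apply, map_sub, sub_apply,
    Finset.sum_sub_distrib]
  simp only [← map_sum, ← sum_apply, hm, map_smul, smul_apply,
    Finset.sum_const, smul_sub, inv_smul_smul₀ hc]
  rw [← Nat.cast_smul_eq_nsmul ℝ]
  simp only [map_smul, inv_smul_smul₀ hc]
  abel

lemma coeffNorm_empCov_sub_le (x : ℕ → Surface) (S : Finset ℕ) :
    coeffNorm e (empCov x S - c) ≤
      coeffNorm e (secondMoment x S - c) + l1Norm e (sampleMean x S) ^ 2 := by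
  rw [empCov_eq, sub_right_comm, pow_two, ← coeffNorm_outer]
  exact coeffNorm_sub_le e _ _

/-- The first two sample moments are `η`-close to those of a centred law with covariance `c`, and
no observation dominates the sample. -/
structure IsTypicalSample (c : SurfaceOp) (x : ℕ → Surface) (N : ℕ) (η : ℝ) : Prop where
  secondMoment_le : coeffNorm e (secondMoment x (Finset.range N) - c) ≤ ENNReal.ofReal η
  mean_le : l1Norm e (sampleMean x (Finset.range N)) ≤ ENNReal.ofReal η
  max_le : ∀ n < N, l1Norm e (x n) ≤ ENNReal.ofReal (η * √N)

variable {e} {x : ℕ → Surface} {N : ℕ} {η : ℝ}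

lemma IsTypicalSample.coeffNorm_empCov_sub_le (h : IsTypicalSample e c x N η) (h0 : 0 ≤ η)
    (h1 : η ≤ 1) : coeffNorm e (empCov x (Finset.range N) - c) ≤ ENNReal.ofReal (2 * η) := by
  refine (SepBand.coeffNorm_empCov_sub_le e x _).trans ?_
  calc _ ≤ ENNReal.ofReal η + ENNReal.ofReal η ^ 2 := by
        gcongr
        · exact h.secondMoment_le
        · exact h.mean_le
    _ = ENNReal.ofReal (η + η ^ 2) := by
        rw [← ENNReal.ofReal_pow h0, ENNReal.ofReal_add h0 (sq_nonneg _)]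
    _ ≤ _ := ENNReal.ofReal_le_ofReal (by nlinarith)

/-- Deleting one observation rescales by `N / (N - 1) ≤ 2` and subtracts a term made small by
`max_le`. The second moment then errs by at most `6η` and the mean by `4η`, and `6η + 16η² ≤ 22η`.
-/
lemma IsTypicalSample.coeffNorm_empCov_erase_sub_le (h : IsTypicalSample e c x N η) (h0 : 0 ≤ η)
    (h1 : η ≤ 1) (hN : 2 ≤ N) (hc : coeffNorm e c ≤ ENNReal.ofReal (η * N)) {n : ℕ}
    (hn : n < N) :
    coeffNorm e (empCov x ((Finset.range N).erase n) - c) ≤ ENNReal.ofReal (22 * η) := by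
  have hNR : (2 : ℝ) ≤ N := by exact_mod_cast hN
  have hN0 : (N : ℝ) ≠ 0 := by positivity
  set a : ℝ := ((N : ℝ) - 1)⁻¹ with ha
  have ha0 : 0 ≤ a := inv_nonneg.2 (by linarith)
  have haN : a * N = 1 + a := by
    rw [ha]
    field_simp [show (N : ℝ) - 1 ≠ 0 by linarith]
    ring
  have ha1 : a ≤ 1 := inv_le_one_of_one_le₀ (by linarith)
  have hcard : ((((Finset.range N).erase n).card : ℝ))⁻¹ = a := by
    rw [Finset.card_erase_of_mem (Finset.mem_range.2 hn), Finset.card_range, ha,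
      Nat.cast_sub (by omega), Nat.cast_one]
  have hm : sampleMean x ((Finset.range N).erase n)
      = a • ((N : ℝ) • sampleMean x (Finset.range N) - x n) := by
    rw [sampleMean, hcard, sampleMean, Finset.card_range, smul_inv_smul₀ hN0,
      Finset.sum_erase_eq_sub (Finset.mem_range.2 hn)]
  have hs : secondMoment x ((Finset.range N).erase n) - c
      = (a * N) • (secondMoment x (Finset.range N) - c) + a • c - a • outer (x n) (x n) := by
    have h2 : (N : ℝ) • secondMoment x (Finset.range N)
        = ∑ n ∈ Finset.range N, outer (x n) (x n) := by
      rw [secondMoment, Finset.card_range, smul_inv_smul₀ hN0]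
    rw [secondMoment, hcard, Finset.sum_erase_eq_sub (Finset.mem_range.2 hn), ← h2, smul_sub,
      smul_smul, smul_sub]
    nth_rw 3 [haN]
    rw [add_smul, one_smul]
    abel
  have hsqrt : √(N : ℝ) ≤ N := Real.sqrt_le_iff.2 ⟨by positivity, by nlinarith⟩
  have hae : ‖a‖ₑ = ENNReal.ofReal a := Real.enorm_of_nonneg ha0
  have hNe : ‖(N : ℝ)‖ₑ = ENNReal.ofReal N := Real.enorm_of_nonneg (by positivity)
  have hb1 : coeffNorm e (secondMoment x ((Finset.range N).erase n) - c)
      ≤ ENNReal.ofReal (6 * η) := by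
    rw [hs]
    calc _ ≤ coeffNorm e ((a * N) • (secondMoment x (Finset.range N) - c))
          + coeffNorm e (a • c) + coeffNorm e (a • outer (x n) (x n)) :=
          (coeffNorm_sub_le e _ _).trans (by gcongr; exact coeffNorm_add_le e _ _)
      _ ≤ ENNReal.ofReal (a * N) * ENNReal.ofReal η + ENNReal.ofReal a * ENNReal.ofReal (η * N)
          + ENNReal.ofReal a * (ENNReal.ofReal (η * √N) * ENNReal.ofReal (η * √N)) := by
          rw [coeffNorm_smul, coeffNorm_smul, coeffNorm_smul, coeffNorm_outer, hae,
            Real.enorm_of_nonneg (show 0 ≤ a * N by positivity)]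
          gcongr
          · exact h.secondMoment_le
          · exact h.max_le n hn
          · exact h.max_le n hn
      _ = ENNReal.ofReal (a * N * η + a * (η * N) + a * ((η * √N) * (η * √N))) := by
          rw [ENNReal.ofReal_add (by positivity) (by positivity),
            ENNReal.ofReal_add (by positivity) (by positivity),
            ENNReal.ofReal_mul (p := a * N) (by positivity),
            ENNReal.ofReal_mul (q := η * N) ha0,
            ENNReal.ofReal_mul (q := (η * √N) * (η * √N)) ha0, ENNReal.ofReal_mul (p := η * √N) (by positivity)]
      _ ≤ _ := by
          refine ENNReal.ofReal_le_ofReal ?_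
          have h3 : a * ((η * √N) * (η * √N)) = (a * N) * η ^ 2 := by
            have := Real.mul_self_sqrt (show (0 : ℝ) ≤ N by positivity)
            linear_combination a * η ^ 2 * this
          rw [h3, haN, show a * (η * N) = (a * N) * η by ring, haN]
          have h4 : η ^ 2 ≤ η := by nlinarith
          nlinarith
  have hb2 : l1Norm e (sampleMean x ((Finset.range N).erase n)) ≤ ENNReal.ofReal (4 * η) := by
    rw [hm]
    calc _ ≤ ENNReal.ofReal a * (ENNReal.ofReal N * ENNReal.ofReal η
          + ENNReal.ofReal (η * √N)) := by
          rw [l1Norm_smul, hae]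
          gcongr
          refine (l1Norm_sub_le e _ _).trans ?_
          rw [l1Norm_smul, hNe]
          gcongr
          · exact h.mean_le
          · exact h.max_le n hn
      _ = ENNReal.ofReal (a * (N * η + η * √N)) := by
          rw [ENNReal.ofReal_mul ha0, ENNReal.ofReal_add (by positivity) (by positivity),
            ENNReal.ofReal_mul (p := (N : ℝ)) (by positivity)]
      _ ≤ _ := by
          refine ENNReal.ofReal_le_ofReal ?_
          calc a * (N * η + η * √N) ≤ a * (N * η + η * N) := by gcongr
            _ = (a * N) * (2 * η) := by ring
            _ ≤ 4 * η := by rw [haN]; nlinarith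
  refine (SepBand.coeffNorm_empCov_sub_le e x _).trans ?_
  calc _ ≤ ENNReal.ofReal (6 * η) + ENNReal.ofReal (4 * η) ^ 2 := by gcongr
    _ = ENNReal.ofReal (6 * η + (4 * η) ^ 2) := by
        rw [← ENNReal.ofReal_pow (by positivity), ENNReal.ofReal_add (by positivity)
          (by positivity)]
    _ ≤ _ := ENNReal.ofReal_le_ofReal (by nlinarith)

lemma IsTypicalSample.mean_norm_sq_le (h : IsTypicalSample e c x N η) (h0 : 0 ≤ η)
    (hc : coeffNorm e c ≠ ∞) :
    (N : ℝ)⁻¹ * ∑ n ∈ Finset.range N, ‖x n‖ ^ 2 ≤ (coeffNorm e c).toReal + η := by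
  rw [← ENNReal.ofReal_le_ofReal_iff (by positivity),
    ENNReal.ofReal_add ENNReal.toReal_nonneg h0, ENNReal.ofReal_toReal hc,
    ENNReal.ofReal_mul (by positivity), ENNReal.ofReal_sum_of_nonneg fun _ _ => sq_nonneg _]
  simp_rw [ENNReal.ofReal_pow (norm_nonneg _), ofReal_norm]
  calc _ ≤ ENNReal.ofReal (N : ℝ)⁻¹ *
        coeffNorm e (∑ n ∈ Finset.range N, outer (x n) (x n)) := by
        gcongr
        exact sum_enorm_sq_le_coeffNorm e x _
    _ = coeffNorm e (c + (secondMoment x (Finset.range N) - c)) := by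
        rw [add_sub_cancel, secondMoment, coeffNorm_smul, Finset.card_range,
          Real.enorm_of_nonneg (by positivity)]
    _ ≤ _ := (coeffNorm_add_le e _ _).trans (by gcongr; exact h.secondMoment_le)

end EmpCov

/-! ## Consistency of the cross-validation criterion -/

section CrossValidation

variable {e : HilbertBasis ℕ ℝ Surface} {c : SurfaceOp}

/-- The error of the cross term splits into replacing the leave-one-out proxies by one fixed `p`,
and replacing the sample second moment by `c`. -/
lemma inner_sub_sum_inner_eq (x : ℕ → Surface) (N : ℕ) (p : SurfaceOp) (q : ℕ → SurfaceOp) :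
    (N : ℝ)⁻¹ * ∑ n ∈ Finset.range N, (inner ℝ (q n) (outer (x n) (x n)) : ℝ) - inner ℝ p c =
      (N : ℝ)⁻¹ * ∑ n ∈ Finset.range N, (inner ℝ (q n - p) (outer (x n) (x n)) : ℝ) +
        inner ℝ p (secondMoment x (Finset.range N) - c) := by
  simp_rw [inner_sub_left, Finset.sum_sub_distrib, inner_sub_right, secondMoment,
    inner_smul_right, inner_sum, Finset.card_range]
  ring

lemma abs_cvCriterion_sub_le {x : ℕ → Surface} {N : ℕ} {η ρ δ : ℝ} (hc : coeffNorm e c ≠ ∞)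
    (h : IsTypicalSample e c x N η) (hη : 0 ≤ η) (hη1 : η ≤ 1) (hρ : 0 ≤ ρ) (hρ1 : ρ ≤ 1)
    (h1 : ‖proxy δ (empCov x (Finset.range N)) - proxy δ c‖ ≤ ρ)
    (h2 : ∀ n < N, ‖proxy δ (empCov x ((Finset.range N).erase n)) - proxy δ c‖ ≤ ρ) :
    |cvCriterion x N δ - (theoreticalCriterion c δ - ‖c‖ ^ 2)| ≤
      ρ * (2 * ‖proxy δ c‖ + 1) + 2 * (ρ * ((coeffNorm e c).toReal + 1) + ‖proxy δ c‖ * η) := by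
  set p := proxy δ c with hp
  set D := (coeffNorm e c).toReal with hD
  have e1 : theoreticalCriterion c δ - ‖c‖ ^ 2 = ‖p‖ ^ 2 - 2 * inner ℝ p c := by
    rw [theoreticalCriterion, norm_sub_sq_real]
    ring
  have e2 := inner_sub_sum_inner_eq (c := c) x N p
    (fun n => proxy δ (empCov x ((Finset.range N).erase n)))
  have e3 : cvCriterion x N δ - (theoreticalCriterion c δ - ‖c‖ ^ 2) =
      (‖proxy δ (empCov x (Finset.range N))‖ ^ 2 - ‖p‖ ^ 2) - 2 *
      ((N : ℝ)⁻¹ * ∑ n ∈ Finset.range N, (inner ℝ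
        (proxy δ (empCov x ((Finset.range N).erase n)) - p) (outer (x n) (x n)) : ℝ) +
        inner ℝ p (secondMoment x (Finset.range N) - c)) := by
    rw [← e2, e1, cvCriterion]
    ring
  have b1 : |‖proxy δ (empCov x (Finset.range N))‖ ^ 2 - ‖p‖ ^ 2| ≤ ρ * (2 * ‖p‖ + 1) := by
    have h3 := (abs_norm_sub_norm_le _ _).trans h1
    have h4 : ‖proxy δ (empCov x (Finset.range N))‖ ≤ ‖p‖ + 1 := by
      linarith [(abs_le.1 h3).2]
    rw [sq_sub_sq, abs_mul, mul_comm]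
    refine mul_le_mul h3 ?_ (abs_nonneg _) hρ
    rw [abs_of_nonneg (by positivity)]
    linarith
  have b2 : |(N : ℝ)⁻¹ * ∑ n ∈ Finset.range N, (inner ℝ
      (proxy δ (empCov x ((Finset.range N).erase n)) - p) (outer (x n) (x n)) : ℝ)| ≤
      ρ * (D + 1) := by
    rw [abs_mul, abs_of_nonneg (by positivity : (0 : ℝ) ≤ (N : ℝ)⁻¹)]
    calc _ ≤ (N : ℝ)⁻¹ * ∑ n ∈ Finset.range N, ρ * ‖x n‖ ^ 2 := by
          gcongr
          refine (Finset.abs_sum_le_sum_abs _ _).trans (Finset.sum_le_sum fun n hn => ?_)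
          refine (abs_real_inner_le_norm _ _).trans ?_
          rw [norm_outer, ← pow_two]
          gcongr
          exact h2 n (Finset.mem_range.1 hn)
      _ = ρ * ((N : ℝ)⁻¹ * ∑ n ∈ Finset.range N, ‖x n‖ ^ 2) := by
          rw [← Finset.mul_sum]
          ring
      _ ≤ ρ * (D + 1) := by
          gcongr
          linarith [h.mean_norm_sq_le hη hc]
  have b3 : |(inner ℝ p (secondMoment x (Finset.range N) - c) : ℝ)| ≤ ‖p‖ * η := by
    refine (abs_real_inner_le_norm _ _).trans ?_
    gcongr
    exact norm_le_of_coeffNorm_le e hη h.secondMoment_le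
  rw [e3]
  refine (abs_sub _ _).trans (add_le_add b1 ?_)
  rw [abs_mul, abs_two]
  gcongr
  exact (abs_add_le _ _).trans (add_le_add b2 b3)

/-- Purely deterministic: the tolerance `η` is fixed before the sample and `N`, so one choice serves
all typical samples. -/
lemma eventually_abs_cvCriterion_sub_lt (hc : coeffNorm e c ≠ ∞) {δ : ℝ}
    (ht : shiftedTrace δ c ≠ 0) {ε : ℝ} (hε : 0 < ε) :
    ∀ᶠ η in 𝓝[>] (0 : ℝ), ∀ (x : ℕ → Surface) (N : ℕ), 2 ≤ N →
      coeffNorm e c ≤ ENNReal.ofReal (η * N) → IsTypicalSample e c x N η →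
      |cvCriterion x N δ - (theoreticalCriterion c δ - ‖c‖ ^ 2)| < ε := by
  obtain ⟨K, hK, hlip⟩ := exists_norm_separablePart_sub_le e hc ht
  set D := (coeffNorm e c).toReal with hD
  have hD0 : 0 ≤ D := ENNReal.toReal_nonneg
  have ev : ∀ (f : ℝ → ℝ), Continuous f → f 0 = 0 → ∀ t > 0, ∀ᶠ η in 𝓝[>] (0 : ℝ), f η < t := by
    intro f hf hf0 t ht
    have h0 := (hf.tendsto 0).mono_left (nhdsWithin_le_nhds (s := Set.Ioi 0))
    rw [hf0] at h0
    exact h0.eventually_lt_const ht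
  -- The radius `22 * η` is the leave-one-out bound; it also covers the `2 * η` of the full sample.
  -- The factor `1 + 2 * K` arises because the separable part enters the proxy twice.
  filter_upwards [self_mem_nhdsWithin, ev (fun η => η) (by fun_prop) rfl 1 one_pos,
    ev (fun η => (1 + 2 * K) * (22 * η)) (by fun_prop) (by simp) 1 one_pos,
    ev (fun η => (1 + 2 * K) * (22 * η) * (2 * ‖proxy δ c‖ + 1) +
      2 * ((1 + 2 * K) * (22 * η) * (D + 1) + ‖proxy δ c‖ * η)) (by fun_prop) (by simp) ε hε]
    with η hη0 hη1 hρ1 hlt x N hN hcN h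
  have hη0 : 0 < η := hη0
  have hprox : ∀ k, coeffNorm e (k - c) ≤ ENNReal.ofReal (22 * η) →
      ‖proxy δ k - proxy δ c‖ ≤ (1 + 2 * K) * (22 * η) := by
    intro k hk
    have h1 := hlip k (22 * η) (by positivity) (by nlinarith) hk
    have h2 := norm_le_of_coeffNorm_le e (by positivity) hk
    have h3 := norm_proxy_sub_le δ k c
    linarith
  refine (abs_cvCriterion_sub_le hc h hη0.le hη1.le (by positivity) hρ1.le ?_ ?_).trans_lt hlt
  · refine hprox _ ((h.coeffNorm_empCov_sub_le hη0.le hη1.le).trans ?_)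
    exact ENNReal.ofReal_le_ofReal (by linarith)
  · intro n hn
    exact hprox _ (h.coeffNorm_empCov_erase_sub_le hη0.le hη1.le hN hcN hn)

/-- A grid point below `δstar` has `Ξ > 0`, since otherwise it would minimise `Ξ`. Approximating the
criterion to within half this gap, there and at a zero of `Ξ`, excludes it as an empirical
minimiser. -/
lemma eventually_le_of_mem_argminOn_cvCriterion (hc : coeffNorm e c ≠ ∞) {Δ : Finset ℝ}
    {δstar : ℝ} (ht : ∀ δ ∈ Δ, shiftedTrace δ c ≠ 0)
    (hzero : ∃ δ ∈ Δ, theoreticalCriterion c δ = 0)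
    (hmin : δstar ∈ lowerBounds (argminOn Δ (theoreticalCriterion c))) :
    ∀ᶠ η in 𝓝[>] (0 : ℝ), ∀ (x : ℕ → Surface) (N : ℕ), 2 ≤ N →
      coeffNorm e c ≤ ENNReal.ofReal (η * N) → IsTypicalSample e c x N η →
      ∀ δ ∈ argminOn Δ (cvCriterion x N), δstar ≤ δ := by
  obtain ⟨δ₀, hδ₀, hz⟩ := hzero
  have hnn : ∀ δ, 0 ≤ theoreticalCriterion c δ := fun δ => sq_nonneg _
  have h : ∀ δ ∈ Δ, ∀ᶠ η in 𝓝[>] (0 : ℝ), ∀ (x : ℕ → Surface) (N : ℕ), 2 ≤ N →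
      coeffNorm e c ≤ ENNReal.ofReal (η * N) → IsTypicalSample e c x N η →
      δ ∈ argminOn Δ (cvCriterion x N) → δstar ≤ δ := by
    intro δ hδ
    rcases (hnn δ).eq_or_lt with h0 | hpos
    · refine Eventually.of_forall fun _ _ _ _ _ _ _ => hmin ⟨hδ, fun δ' _ => ?_⟩
      rw [← h0]
      exact hnn δ'
    · filter_upwards [eventually_abs_cvCriterion_sub_lt hc (ht δ hδ) (half_pos hpos),
        eventually_abs_cvCriterion_sub_lt hc (ht δ₀ hδ₀) (half_pos hpos)]
        with η h1 h2 x N hN hcN hx hmem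
      have h3 := (abs_lt.1 (h1 x N hN hcN hx)).1
      have h4 := (abs_lt.1 (h2 x N hN hcN hx)).2
      have h5 := hmem.2 δ₀ hδ₀
      linarith
  filter_upwards [(eventually_all_finset Δ).2 h] with η hη x N hN hcN hx δ hδ
  exact hη δ hδ.1 x N hN hcN hx hδ

end CrossValidation

/-! ## Moment bounds for sample averages -/

section Averages

variable {Ω : Type*} [MeasurableSpace Ω] {P : Measure Ω}

instance holderTriple_four_four_two : ENNReal.HolderTriple 4 4 2 where
  inv_add_inv_eq_inv := by
    rw [← two_mul, show (4 : ℝ≥0∞) = 2 * 2 by norm_num,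
      ENNReal.mul_inv (Or.inl two_ne_zero) (Or.inl ENNReal.ofNat_ne_top), ← mul_assoc,
      ENNReal.mul_inv_cancel two_ne_zero ENNReal.ofNat_ne_top, one_mul]

lemma eLpNorm_mul_two_le {f g : Ω → ℝ} (hf : AEStronglyMeasurable f P)
    (hg : AEStronglyMeasurable g P) :
    eLpNorm (fun ω => f ω * g ω) 2 P ≤ eLpNorm f 4 P * eLpNorm g 4 P := by
  have h := eLpNorm_smul_le_mul_eLpNorm (p := 4) (q := 4) (r := 2) hg hf
  rw [show (fun ω => f ω * g ω) = f • g from rfl]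
  exact h

lemma lintegral_enorm_mul_enorm_le {f g : Ω → ℝ} (hf : AEStronglyMeasurable f P)
    (hg : AEStronglyMeasurable g P) :
    ∫⁻ ω, ‖f ω‖ₑ * ‖g ω‖ₑ ∂P ≤ eLpNorm f 2 P * eLpNorm g 2 P := by
  refine le_trans (le_of_eq ?_) (eLpNorm_smul_le_mul_eLpNorm (p := 2) (q := 2) (r := 1) hg hf)
  rw [eLpNorm_one_eq_lintegral_enorm]
  simp [enorm_mul]

lemma lintegral_enorm_le_eLpNorm_two [IsProbabilityMeasure P] {f : Ω → ℝ}
    (hf : AEStronglyMeasurable f P) : ∫⁻ ω, ‖f ω‖ₑ ∂P ≤ eLpNorm f 2 P := by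
  rw [← eLpNorm_one_eq_lintegral_enorm]
  exact eLpNorm_le_eLpNorm_of_exponent_le (by norm_num) hf

/-- Minkowski's inequality for series in `L²`, by expanding the square and applying Cauchy-Schwarz
to each pair. -/
lemma lintegral_tsum_enorm_sq_le {ι : Type*} [Countable ι] {f : ι → Ω → ℝ}
    (hf : ∀ i, AEStronglyMeasurable (f i) P) :
    ∫⁻ ω, (∑' i, ‖f i ω‖ₑ) ^ 2 ∂P ≤ (∑' i, eLpNorm (f i) 2 P) ^ 2 := by
  simp_rw [pow_two, ← ENNReal.tsum_mul_right, ← ENNReal.tsum_mul_left]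
  have hm : ∀ i j, AEMeasurable (fun ω => ‖f i ω‖ₑ * ‖f j ω‖ₑ) P := fun i j =>
    (hf i).enorm.mul (hf j).enorm
  rw [lintegral_tsum fun i => AEMeasurable.tsum fun j => hm i j]
  gcongr with i
  rw [lintegral_tsum fun j => hm i j]
  gcongr with j
  exact lintegral_enorm_mul_enorm_le (hf i) (hf j)

/-- Pairwise independence divides the variance by `N`; the first absolute moment is at most the
standard deviation. -/
lemma lintegral_enorm_average_sub_le [IsProbabilityMeasure P] {Z : ℕ → Ω → ℝ}
    (hindep : Pairwise fun i j => IndepFun (Z i) (Z j) P)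
    (hident : ∀ n, IdentDistrib (Z n) (Z 0) P P) (hZ : MemLp (Z 0) 2 P) (N : ℕ) (hN : N ≠ 0) :
    ∫⁻ ω, ‖(N : ℝ)⁻¹ * ∑ n ∈ Finset.range N, Z n ω - ∫ ω', Z 0 ω' ∂P‖ₑ ∂P ≤
      ENNReal.ofReal (√N)⁻¹ * eLpNorm (Z 0) 2 P := by
  have hZn : ∀ n, MemLp (Z n) 2 P := fun n => (hident n).memLp_iff.2 hZ
  have hN0 : (N : ℝ) ≠ 0 := by exact_mod_cast hN
  set W : Ω → ℝ := fun ω => (N : ℝ)⁻¹ * (∑ n ∈ Finset.range N, Z n) ω with hW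
  have hWm : MemLp W 2 P := (memLp_finsetSum' _ fun n _ => hZn n).const_mul _
  have hmean : ∫ ω, W ω ∂P = ∫ ω, Z 0 ω ∂P := by
    rw [hW, integral_const_mul]
    simp_rw [Finset.sum_apply]
    rw [integral_finsetSum _ fun n _ => (hZn n).integrable (by norm_num)]
    simp_rw [fun n => (hident n).integral_eq]
    rw [Finset.sum_const, Finset.card_range, nsmul_eq_mul, inv_mul_cancel_left₀ hN0]
  have hvar : variance W P = (N : ℝ)⁻¹ * variance (Z 0) P := by
    rw [hW, variance_const_mul, IndepFun.variance_sum (fun n _ => hZn n)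
      fun i _ j _ hij => hindep hij]
    simp_rw [fun n => (hident n).variance_eq]
    rw [Finset.sum_const, Finset.card_range, nsmul_eq_mul]
    field_simp
  have hsq : eLpNorm (fun ω => W ω - ∫ ω', W ω' ∂P) 2 P ^ 2 ≤
      (ENNReal.ofReal (√N)⁻¹ * eLpNorm (Z 0) 2 P) ^ 2 := by
    have h2 : ∀ f : Ω → ℝ, eLpNorm f 2 P ^ 2 = ∫⁻ ω, ‖f ω‖ₑ ^ 2 ∂P := fun f => by
      have := eLpNorm_nnreal_pow_eq_lintegral (μ := P) (f := f) (p := 2) two_ne_zero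
      simpa using this
    rw [h2, mul_pow]
    change evariance W P ≤ _
    rw [← ofReal_variance hWm, hvar, ENNReal.ofReal_mul (by positivity),
      ← ENNReal.ofReal_pow (by positivity), inv_pow, Real.sq_sqrt (by positivity)]
    gcongr
    rw [h2]
    refine (ENNReal.ofReal_le_ofReal (variance_le_expectation_sq hZ.1)).trans ?_
    simp_rw [Pi.pow_apply]
    rw [ofReal_integral_eq_lintegral_ofReal hZ.integrable_sq (ae_of_all _ fun _ => sq_nonneg _)]
    refine lintegral_mono fun ω => ?_
    rw [← Real.enorm_of_nonneg (sq_nonneg _), enorm_pow]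
  have hle := (ENNReal.pow_le_pow_left_iff two_ne_zero).1 hsq
  refine le_trans ?_ ((lintegral_enorm_le_eLpNorm_two
    (hWm.sub (memLp_const (∫ ω, W ω ∂P))).1).trans hle)
  rw [hmean]
  refine le_of_eq (lintegral_congr fun ω => ?_)
  simp [hW]

end Averages

/-! ## Random surfaces -/

section RandomSurface

lemma coeffNorm_outer_self (e : HilbertBasis ℕ ℝ Surface) (x : Surface) : coeffNorm e (outer x x) =
    ∑' p : ℕ × ℕ, ‖(inner ℝ x (e p.1) : ℝ) * inner ℝ x (e p.2)‖ₑ := by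
  simp_rw [coeffNorm, inner_outer_outer]

lemma continuous_outer_self : Continuous fun x : Surface => outer x x := by
  have h : Continuous fun x : Surface => outerL x x :=
    outerL.continuous.clm_apply continuous_id
  exact h

instance : SecondCountableTopology Surface :=
  haveI : Fact ((2 : ℝ≥0∞) ≠ ∞) := ⟨ENNReal.ofNat_ne_top⟩
  haveI : IsSeparable (volume : Measure (I × I)) := isSeparable_of_sigmaFinite _
  Lp.SecondCountableTopology

variable {Ω : Type*} [MeasurableSpace Ω] {P : Measure Ω}

/-- Markov's inequality for a series of nonnegative random variables. -/
lemma measure_ofReal_lt_tsum_le {ι : Type*} [Countable ι] {f : ι → Ω → ℝ≥0∞}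
    (hf : ∀ i, AEMeasurable (f i) P) {A : ℝ≥0∞} (hA : ∑' i, ∫⁻ ω, f i ω ∂P ≤ A) {t : ℝ}
    (ht : 0 < t) : P {ω | ENNReal.ofReal t < ∑' i, f i ω} ≤ ENNReal.ofReal t⁻¹ * A := by
  rw [← lintegral_tsum hf] at hA
  calc P {ω | ENNReal.ofReal t < ∑' i, f i ω}
      ≤ P {ω | ENNReal.ofReal t ≤ ∑' i, f i ω} :=
        measure_mono fun ω (hω : ENNReal.ofReal t < ∑' i, f i ω) => hω.le
    _ ≤ (∫⁻ ω, ∑' i, f i ω ∂P) / ENNReal.ofReal t :=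
        meas_ge_le_lintegral_div (AEMeasurable.tsum hf) (by simpa using ht)
          ENNReal.ofReal_ne_top
    _ ≤ ENNReal.ofReal t⁻¹ * A := by
        rw [ENNReal.ofReal_inv_of_pos ht, ENNReal.div_eq_inv_mul]
        gcongr

variable [MeasurableSpace Surface] [BorelSpace Surface] (e : HilbertBasis ℕ ℝ Surface)

/-- The moment sum `∑ⱼ (E ⟨Y, eⱼ⟩⁴)^{1/4}`. -/
def momentSum (P : Measure Ω) (Y : Ω → Surface) : ℝ≥0∞ :=
  ∑' j, eLpNorm (fun ω => (inner ℝ (Y ω) (e j) : ℝ)) 4 P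

variable {Y : Ω → Surface}

lemma measurable_inner_const (f : Surface) :
    Measurable fun x : Surface => (inner ℝ x f : ℝ) :=
  (continuous_id.inner continuous_const).measurable

lemma measurable_l1Norm : Measurable (l1Norm e) :=
  Measurable.tsum fun j => (measurable_inner_const (e j)).enorm

lemma aestronglyMeasurable_inner_const (hY : AEMeasurable Y P) (f : Surface) :
    AEStronglyMeasurable (fun ω => (inner ℝ (Y ω) f : ℝ)) P :=
  ((measurable_inner_const f).comp_aemeasurable hY).aestronglyMeasurable

lemma tsum_eLpNorm_inner_mul_inner_le (hY : AEMeasurable Y P) :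
    ∑' p : ℕ × ℕ, eLpNorm (fun ω => (inner ℝ (Y ω) (e p.1) : ℝ) * inner ℝ (Y ω) (e p.2)) 2 P ≤
      momentSum e P Y ^ 2 := by
  rw [momentSum, pow_two, ← ENNReal.tsum_mul_right]
  simp_rw [← ENNReal.tsum_mul_left]
  rw [ENNReal.tsum_prod']
  gcongr with i j
  exact eLpNorm_mul_two_le (aestronglyMeasurable_inner_const hY _)
    (aestronglyMeasurable_inner_const hY _)

/-- The squared `l1Norm` is the coefficient sum of `Y ⊗ Y`, so Minkowski in `L²` and Hölder on each
coefficient suffice. -/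
lemma lintegral_l1Norm_pow_four_le (hY : AEMeasurable Y P) :
    ∫⁻ ω, l1Norm e (Y ω) ^ 4 ∂P ≤ momentSum e P Y ^ 4 := by
  have h := lintegral_tsum_enorm_sq_le (P := P)
    (f := fun (p : ℕ × ℕ) ω => (inner ℝ (Y ω) (e p.1) : ℝ) * inner ℝ (Y ω) (e p.2))
    fun p => (aestronglyMeasurable_inner_const hY _).mul (aestronglyMeasurable_inner_const hY _)
  simp_rw [← coeffNorm_outer_self, coeffNorm_outer, ← pow_two, ← pow_mul] at h
  refine h.trans ?_
  calc _ ≤ (momentSum e P Y ^ 2) ^ 2 := by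
        gcongr
        exact tsum_eLpNorm_inner_mul_inner_le e hY
    _ = _ := by rw [← pow_mul]

lemma memLp_inner_mul_inner (hY : AEMeasurable Y P) (hS : momentSum e P Y ≠ ∞) (i j : ℕ) :
    MemLp (fun ω => (inner ℝ (Y ω) (e i) : ℝ) * inner ℝ (Y ω) (e j)) 2 P := by
  refine ⟨(aestronglyMeasurable_inner_const hY _).mul
    (aestronglyMeasurable_inner_const hY _), ?_⟩
  refine lt_of_le_of_lt ?_ (ENNReal.pow_lt_top hS.lt_top (n := 2))
  exact (ENNReal.le_tsum (f := fun p : ℕ × ℕ => eLpNorm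
    (fun ω => (inner ℝ (Y ω) (e p.1) : ℝ) * inner ℝ (Y ω) (e p.2)) 2 P) (i, j)).trans
    (tsum_eLpNorm_inner_mul_inner_le e hY)

variable {X : ℕ → Ω → Surface}

/-- Markov for the fourth power gives order `N⁻²` per observation, so the union over `N`
observations still tends to zero. -/
lemma measure_exists_l1Norm_le (hident : ∀ n, IdentDistrib (X n) (X 0) P P) {N : ℕ} (hN : N ≠ 0)
    {η : ℝ} (hη : 0 < η) :
    P {ω | ∃ n < N, ENNReal.ofReal (η * √N) < l1Norm e (X n ω)} ≤
      ENNReal.ofReal (η ^ 4 * N)⁻¹ * momentSum e P (X 0) ^ 4 := by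
  have hNR : (0 : ℝ) < N := by exact_mod_cast Nat.pos_of_ne_zero hN
  have ht : 0 < η * √N := mul_pos hη (Real.sqrt_pos.2 hNR)
  have ht4 : (η * √N) ^ 4 = η ^ 4 * (N : ℝ) ^ 2 := by
    rw [mul_pow, show (4 : ℕ) = 2 * 2 from rfl, pow_mul (√(N : ℝ)), Real.sq_sqrt hNR.le]
  have hone : ∀ n, P {ω | ENNReal.ofReal (η * √N) < l1Norm e (X n ω)} ≤
      ENNReal.ofReal (η ^ 4 * (N : ℝ) ^ 2)⁻¹ * momentSum e P (X 0) ^ 4 := by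
    intro n
    have hm : AEMeasurable (fun ω => l1Norm e (X n ω) ^ 4) P :=
      ((measurable_l1Norm e).comp_aemeasurable (hident n).aemeasurable_fst).pow_const 4
    have hA : ∫⁻ ω, l1Norm e (X n ω) ^ 4 ∂P ≤ momentSum e P (X 0) ^ 4 := by
      refine (((hident n).comp ((measurable_l1Norm e).pow_const 4)).lintegral_eq).trans_le ?_
      exact lintegral_l1Norm_pow_four_le e (hident 0).aemeasurable_fst
    have h := measure_ofReal_lt_tsum_le (ι := Unit)
      (f := fun _ ω => l1Norm e (X n ω) ^ 4) (fun _ => hm) (by simpa using hA)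
      (pow_pos ht 4)
    rw [ht4] at h
    refine le_trans (measure_mono fun ω hω => ?_) h
    rw [Set.mem_ofPred_eq] at hω ⊢
    rw [tsum_fintype, Fintype.sum_unique, ← ht4, ENNReal.ofReal_pow ht.le]
    exact (ENNReal.pow_lt_pow_left_iff (by norm_num)).2 hω
  calc _ ≤ P (⋃ n ∈ Finset.range N, {ω | ENNReal.ofReal (η * √N) < l1Norm e (X n ω)}) := by
        refine measure_mono fun ω ⟨n, hn, hω⟩ => ?_
        simp only [Set.mem_iUnion]
        exact ⟨n, Finset.mem_range.2 hn, hω⟩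
    _ ≤ ∑ n ∈ Finset.range N, P {ω | ENNReal.ofReal (η * √N) < l1Norm e (X n ω)} :=
        measure_biUnion_finset_le _ _
    _ ≤ ∑ n ∈ Finset.range N,
          ENNReal.ofReal (η ^ 4 * (N : ℝ) ^ 2)⁻¹ * momentSum e P (X 0) ^ 4 :=
        Finset.sum_le_sum fun n _ => hone n
    _ = _ := by
        rw [Finset.sum_const, Finset.card_range, nsmul_eq_mul, ← mul_assoc,
          ← ENNReal.ofReal_natCast, ← ENNReal.ofReal_mul hNR.le]
        congr 2
        field_simp

variable [IsProbabilityMeasure P]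

lemma lintegral_l1Norm_le (hY : AEMeasurable Y P) :
    ∫⁻ ω, l1Norm e (Y ω) ∂P ≤ momentSum e P Y := by
  simp_rw [l1Norm]
  rw [lintegral_tsum fun j => (aestronglyMeasurable_inner_const hY (e j)).enorm, momentSum]
  gcongr with j
  exact (lintegral_enorm_le_eLpNorm_two (aestronglyMeasurable_inner_const hY _)).trans
    (eLpNorm_le_eLpNorm_of_exponent_le (by norm_num) (aestronglyMeasurable_inner_const hY _))

lemma integrable_of_momentSum_ne_top (hY : AEMeasurable Y P) (hS : momentSum e P Y ≠ ∞) :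
    Integrable Y P := by
  refine ⟨hY.aestronglyMeasurable, ?_⟩
  refine (lintegral_mono fun ω => enorm_le_l1Norm e (Y ω)).trans_lt ?_
  exact (lintegral_l1Norm_le e hY).trans_lt hS.lt_top

lemma integrable_outer_self (hY : AEMeasurable Y P) (hS : momentSum e P Y ≠ ∞) :
    Integrable (fun ω => outer (Y ω) (Y ω)) P := by
  refine ⟨continuous_outer_self.comp_aestronglyMeasurable hY.aestronglyMeasurable, ?_⟩
  refine (lintegral_mono fun ω => enorm_le_coeffNorm e _).trans_lt ?_
  simp_rw [coeffNorm_outer_self]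
  have hm : ∀ p : ℕ × ℕ, AEStronglyMeasurable
      (fun ω => (inner ℝ (Y ω) (e p.1) : ℝ) * inner ℝ (Y ω) (e p.2)) P := fun p =>
    (aestronglyMeasurable_inner_const hY _).mul (aestronglyMeasurable_inner_const hY _)
  rw [lintegral_tsum fun p => (hm p).enorm]
  refine lt_of_le_of_lt ?_ (ENNReal.pow_lt_top hS.lt_top (n := 2))
  refine le_trans ?_ (tsum_eLpNorm_inner_mul_inner_le e hY)
  gcongr with p
  exact lintegral_enorm_le_eLpNorm_two (hm p)

lemma inner_covariance (hY : AEMeasurable Y P) (hS : momentSum e P Y ≠ ∞)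
    (hmean : ∫ ω, Y ω ∂P = 0) (i j : ℕ) :
    (inner ℝ (covariance P Y) (outer (e i) (e j)) : ℝ) =
      ∫ ω, (inner ℝ (Y ω) (e i) : ℝ) * inner ℝ (Y ω) (e j) ∂P := by
  simp_rw [covariance, hmean, sub_zero]
  rw [real_inner_comm, ← integral_inner (integrable_outer_self e hY hS)]
  simp_rw [real_inner_comm _ (outer (e i) (e j)), inner_outer_outer]

lemma coeffNorm_covariance_le (hY : AEMeasurable Y P) (hS : momentSum e P Y ≠ ∞)
    (hmean : ∫ ω, Y ω ∂P = 0) : coeffNorm e (covariance P Y) ≤ momentSum e P Y ^ 2 := by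
  refine le_trans ?_ (tsum_eLpNorm_inner_mul_inner_le e hY)
  rw [coeffNorm]
  gcongr with p
  rw [inner_covariance e hY hS hmean]
  exact (enorm_integral_le_lintegral_enorm _).trans
    (lintegral_enorm_le_eLpNorm_two (memLp_inner_mul_inner e hY hS _ _).1)

/-- Each coefficient is a centred average of products of two coordinates. The mean absolute
deviations carry the factor `N^{-1/2}` and are summable by the moment condition, so Markov applies
to the whole series. -/
lemma measure_coeffNorm_secondMoment_sub_le (hindep : iIndepFun X P)
    (hident : ∀ n, IdentDistrib (X n) (X 0) P P) (hmean : ∫ ω, X 0 ω ∂P = 0)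
    (hS : momentSum e P (X 0) ≠ ∞) {N : ℕ} (hN : N ≠ 0) {t : ℝ} (ht : 0 < t) :
    P {ω | ENNReal.ofReal t < coeffNorm e
      (secondMoment (fun n => X n ω) (Finset.range N) - covariance P (X 0))} ≤
      ENNReal.ofReal t⁻¹ * (ENNReal.ofReal (√N)⁻¹ * momentSum e P (X 0) ^ 2) := by
  have hm := fun n => (hident n).aemeasurable_fst
  have hu : ∀ p : ℕ × ℕ, Measurable fun x : Surface =>
      (inner ℝ x (e p.1) : ℝ) * inner ℝ x (e p.2) := fun p =>
    (measurable_inner_const _).mul (measurable_inner_const _)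
  have heq : ∀ ω (p : ℕ × ℕ), (inner ℝ (secondMoment (fun n => X n ω) (Finset.range N) -
      covariance P (X 0)) (outer (e p.1) (e p.2)) : ℝ) = (N : ℝ)⁻¹ * ∑ n ∈ Finset.range N,
        ((inner ℝ (X n ω) (e p.1) : ℝ) * inner ℝ (X n ω) (e p.2)) -
        ∫ ω', (inner ℝ (X 0 ω') (e p.1) : ℝ) * inner ℝ (X 0 ω') (e p.2) ∂P := by
    intro ω p
    rw [inner_sub_left, inner_covariance e (hm 0) hS hmean, secondMoment, Finset.card_range,
      real_inner_smul_left, sum_inner]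
    simp_rw [inner_outer_outer]
  simp_rw [coeffNorm, heq]
  refine measure_ofReal_lt_tsum_le ?_ ?_ ht
  · intro p
    refine AEMeasurable.enorm (AEMeasurable.sub_const (AEMeasurable.const_mul ?_ _) _)
    exact Finset.aemeasurable_fun_sum _ fun n _ => (hu p).comp_aemeasurable (hm n)
  · refine le_trans ?_ (mul_le_mul_right (tsum_eLpNorm_inner_mul_inner_le e (hm 0)) _)
    rw [← ENNReal.tsum_mul_left]
    gcongr with p
    exact lintegral_enorm_average_sub_le
      (Z := fun n ω => (inner ℝ (X n ω) (e p.1) : ℝ) * inner ℝ (X n ω) (e p.2))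
      (fun i j hij => (hindep.indepFun hij).comp (hu p) (hu p))
      (fun n => (hident n).comp (hu p)) (memLp_inner_mul_inner e (hm 0) hS _ _) N hN

lemma measure_l1Norm_sampleMean_le (hindep : iIndepFun X P)
    (hident : ∀ n, IdentDistrib (X n) (X 0) P P) (hmean : ∫ ω, X 0 ω ∂P = 0)
    (hS : momentSum e P (X 0) ≠ ∞) {N : ℕ} (hN : N ≠ 0) {t : ℝ} (ht : 0 < t) :
    P {ω | ENNReal.ofReal t < l1Norm e (sampleMean (fun n => X n ω) (Finset.range N))} ≤
      ENNReal.ofReal t⁻¹ * (ENNReal.ofReal (√N)⁻¹ * momentSum e P (X 0)) := by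
  have hm := fun n => (hident n).aemeasurable_fst
  have hcoord : ∀ j, ∫ ω, (inner ℝ (X 0 ω) (e j) : ℝ) ∂P = 0 := fun j => by
    simp_rw [real_inner_comm (e j)]
    rw [integral_inner (integrable_of_momentSum_ne_top e (hm 0) hS), hmean, inner_zero_right]
  have heq : ∀ ω j, (inner ℝ (sampleMean (fun n => X n ω) (Finset.range N)) (e j) : ℝ) =
      (N : ℝ)⁻¹ * ∑ n ∈ Finset.range N, (inner ℝ (X n ω) (e j) : ℝ) -
        ∫ ω', (inner ℝ (X 0 ω') (e j) : ℝ) ∂P := by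
    intro ω j
    rw [sampleMean, Finset.card_range, real_inner_smul_left, sum_inner, hcoord, sub_zero]
  simp_rw [l1Norm, heq]
  refine measure_ofReal_lt_tsum_le ?_ ?_ ht
  · intro j
    refine AEMeasurable.enorm (AEMeasurable.sub_const (AEMeasurable.const_mul ?_ _) _)
    exact Finset.aemeasurable_fun_sum _ fun n _ =>
      (measurable_inner_const _).comp_aemeasurable (hm n)
  · rw [momentSum, ← ENNReal.tsum_mul_left]
    gcongr with j
    have h4 : eLpNorm (fun ω => (inner ℝ (X 0 ω) (e j) : ℝ)) 2 P ≤
        eLpNorm (fun ω => (inner ℝ (X 0 ω) (e j) : ℝ)) 4 P :=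
      eLpNorm_le_eLpNorm_of_exponent_le (by norm_num)
        (aestronglyMeasurable_inner_const (hm 0) _)
    have hlt : eLpNorm (fun ω => (inner ℝ (X 0 ω) (e j) : ℝ)) 4 P < ∞ :=
      (ENNReal.le_tsum (f := fun j => eLpNorm (fun ω => (inner ℝ (X 0 ω) (e j) : ℝ)) 4 P)
        j).trans_lt hS.lt_top
    refine (lintegral_enorm_average_sub_le (Z := fun n ω => (inner ℝ (X n ω) (e j) : ℝ))
      (fun i k hik => (hindep.indepFun hik).comp (measurable_inner_const _)
        (measurable_inner_const _))
      (fun n => (hident n).comp (measurable_inner_const _))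
      ⟨aestronglyMeasurable_inner_const (hm 0) _, h4.trans_lt hlt⟩ N hN).trans ?_
    gcongr

end RandomSurface

/-! ### From typical samples to the stochastic rate. -/

section Rate

lemma tendsto_const_div_sqrt (R : ℝ) :
    Tendsto (fun N : ℕ => R / √(N : ℝ)) atTop (𝓝 0) :=
  (Real.tendsto_sqrt_atTop.comp tendsto_natCast_atTop_atTop).const_div_atTop R

variable {Ω : Type*} [MeasurableSpace Ω] {P : Measure Ω} [IsProbabilityMeasure P]
  [MeasurableSpace Surface] [BorelSpace Surface] (e : HilbertBasis ℕ ℝ Surface)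
  {X : ℕ → Ω → Surface}

lemma exists_eventually_measure_not_typical_le (hindep : iIndepFun X P)
    (hident : ∀ n, IdentDistrib (X n) (X 0) P P) (hmean : ∫ ω, X 0 ω ∂P = 0)
    (hS : momentSum e P (X 0) ≠ ∞) {η ε : ℝ} (hη : 0 < η) (hε : 0 < ε) :
    ∃ R : ℝ, 0 < R ∧ ∀ᶠ N : ℕ in atTop,
      P {ω | ¬ (IsTypicalSample e (covariance P (X 0)) (fun n => X n ω) N η ∧
        coeffNorm e (empCov (fun n => X n ω) (Finset.range N) - covariance P (X 0)) ≤
          ENNReal.ofReal (R / √N))} ≤ ENNReal.ofReal ε := by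
  set c := covariance P (X 0) with hc
  set s := (momentSum e P (X 0)).toReal with hs
  have hs0 : 0 ≤ s := ENNReal.toReal_nonneg
  have hSs : momentSum e P (X 0) = ENNReal.ofReal s := (ENNReal.ofReal_toReal hS).symm
  -- Markov at level `R / √N` costs `(s ^ 2 + s) / R` for the second moment and the mean together,
  -- at most `ε / 2`. The summand `1` keeps `R` positive when `s = 0`.
  set R : ℝ := 2 * (s ^ 2 + s + 1) / ε with hR
  have hR0 : 0 < R := by positivity
  have hRε : R⁻¹ * (s ^ 2 + s) ≤ ε / 2 := by
    rw [hR, inv_div, div_mul_eq_mul_div, div_le_div_iff₀ (by positivity) two_pos]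
    nlinarith
  -- The factor `2` absorbs the squared mean: `t + t ^ 2 ≤ 2 * t` for `t ≤ 1`.
  refine ⟨2 * R, by positivity, ?_⟩
  have hlim : Tendsto (fun N : ℕ => (η ^ 4 * (N : ℝ))⁻¹ * s ^ 4) atTop (𝓝 0) := by
    have : Tendsto (fun N : ℕ => (η ^ 4 * (N : ℝ))⁻¹) atTop (𝓝 0) :=
      (tendsto_natCast_atTop_atTop.const_mul_atTop (by positivity)).inv_tendsto_atTop
    simpa using this.mul_const (s ^ 4)
  filter_upwards [eventually_ne_atTop 0,
    (tendsto_const_div_sqrt R).eventually_le_const hη,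
    (tendsto_const_div_sqrt R).eventually_le_const one_pos,
    hlim.eventually_le_const (half_pos hε)] with N hN ht1 ht2 hmax
  have hNR : (0 : ℝ) < N := by exact_mod_cast Nat.pos_of_ne_zero hN
  set t := R / √(N : ℝ) with ht
  have ht0 : 0 < t := div_pos hR0 (Real.sqrt_pos.2 hNR)
  have htR : t⁻¹ * (√(N : ℝ))⁻¹ = R⁻¹ := by
    have := (Real.sqrt_pos.2 hNR).ne'
    rw [ht]
    field_simp
  have h1 := measure_coeffNorm_secondMoment_sub_le e hindep hident hmean hS hN ht0
  have h2 := measure_l1Norm_sampleMean_le e hindep hident hmean hS hN ht0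
  have h3 := measure_exists_l1Norm_le e hident hN hη
  rw [hSs, ← mul_assoc, ← ENNReal.ofReal_mul (by positivity), htR,
    ← ENNReal.ofReal_pow hs0, ← ENNReal.ofReal_mul (by positivity)] at h1
  rw [hSs, ← mul_assoc, ← ENNReal.ofReal_mul (by positivity), htR,
    ← ENNReal.ofReal_mul (by positivity)] at h2
  rw [hSs, ← ENNReal.ofReal_pow hs0, ← ENNReal.ofReal_mul (by positivity)] at h3
  have hsub : {ω | ¬ (IsTypicalSample e c (fun n => X n ω) N η ∧
        coeffNorm e (empCov (fun n => X n ω) (Finset.range N) - c) ≤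
          ENNReal.ofReal (2 * R / √N))} ⊆
      ({ω | ENNReal.ofReal t < coeffNorm e
        (secondMoment (fun n => X n ω) (Finset.range N) - c)} ∪
      {ω | ENNReal.ofReal t < l1Norm e (sampleMean (fun n => X n ω) (Finset.range N))}) ∪
      {ω | ∃ n < N, ENNReal.ofReal (η * √N) < l1Norm e (X n ω)} := by
    intro ω hω
    by_contra hcon
    simp only [Set.mem_union, Set.mem_ofPred_eq, not_or, not_lt, not_exists, not_and] at hcon
    obtain ⟨⟨g1, g2⟩, g3⟩ := hcon
    refine hω ⟨⟨g1.trans (ENNReal.ofReal_le_ofReal ht1),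
      g2.trans (ENNReal.ofReal_le_ofReal ht1), g3⟩, ?_⟩
    refine (coeffNorm_empCov_sub_le e _ _).trans ?_
    calc _ ≤ ENNReal.ofReal t + ENNReal.ofReal t ^ 2 := by gcongr
      _ = ENNReal.ofReal (t + t ^ 2) := by
          rw [← ENNReal.ofReal_pow ht0.le, ENNReal.ofReal_add ht0.le (sq_nonneg _)]
      _ ≤ _ := by
          refine ENNReal.ofReal_le_ofReal ?_
          rw [mul_div_assoc, ← ht]
          nlinarith
  calc _ ≤ _ := measure_mono hsub
    _ ≤ ENNReal.ofReal (R⁻¹ * s ^ 2) + ENNReal.ofReal (R⁻¹ * s) +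
          ENNReal.ofReal ((η ^ 4 * N)⁻¹ * s ^ 4) :=
        (measure_union_le _ _).trans
          (add_le_add ((measure_union_le _ _).trans (add_le_add h1 h2)) h3)
    _ = ENNReal.ofReal (R⁻¹ * s ^ 2 + R⁻¹ * s + (η ^ 4 * N)⁻¹ * s ^ 4) := by
        rw [ENNReal.ofReal_add (by positivity) (by positivity),
          ENNReal.ofReal_add (by positivity) (by positivity)]
    _ ≤ ENNReal.ofReal ε := ENNReal.ofReal_le_ofReal (by linarith)

/-- If `‖D‖ ≤ L r` whenever the sample is typical and its covariance is `r`-close to the true one,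
then `‖D‖² = O_P(N⁻¹)`. -/
lemma isBigOInProbability_of_typical (hindep : iIndepFun X P)
    (hident : ∀ n, IdentDistrib (X n) (X 0) P P) (hmean : ∫ ω, X 0 ω ∂P = 0)
    (hS : momentSum e P (X 0) ≠ ∞) {η L : ℝ} (hη : 0 < η) (hL : 0 < L) {N₀ : ℕ}
    {D : ℕ → Ω → SurfaceOp}
    (hD : ∀ N ≥ N₀, ∀ᵐ ω ∂P, IsTypicalSample e (covariance P (X 0)) (fun n => X n ω) N η →
      ∀ r : ℝ, 0 ≤ r → L * r ≤ 1 →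
        coeffNorm e (empCov (fun n => X n ω) (Finset.range N) - covariance P (X 0)) ≤
          ENNReal.ofReal r → ‖D N ω‖ ≤ L * r) :
    IsBigOInProbability P (fun N ω => ‖D N ω‖ ^ 2) (fun N => (N : ℝ)⁻¹) := by
  intro ε hε
  obtain ⟨R, hR, h⟩ := exists_eventually_measure_not_typical_le e hindep hident hmean hS hη hε
  refine ⟨(L * R) ^ 2, by positivity, ?_⟩
  filter_upwards [h, eventually_ge_atTop N₀,
    (tendsto_const_div_sqrt (L * R)).eventually_le_const one_pos] with N hN hN₀ hsmall
  refine le_trans (measure_mono_ae ?_) hN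
  filter_upwards [hD N hN₀] with ω hω
  intro hbig
  change ¬ _
  rintro ⟨htyp, hcov⟩
  have h1 := hω htyp (R / √N) (by positivity) (by rw [← mul_div_assoc]; exact hsmall) hcov
  have h2 : ‖D N ω‖ ^ 2 ≤ (L * R) ^ 2 * (N : ℝ)⁻¹ := by
    calc ‖D N ω‖ ^ 2 ≤ (L * (R / √N)) ^ 2 := by gcongr
      _ = (L * R) ^ 2 * (N : ℝ)⁻¹ := by
        rw [← mul_div_assoc, div_pow, Real.sq_sqrt (by positivity), div_eq_mul_inv]
  have h3 : (L * R) ^ 2 * (N : ℝ)⁻¹ < |‖D N ω‖ ^ 2| := hbig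
  rw [abs_of_nonneg (sq_nonneg _)] at h3
  linarith

end Rate

end SepBand

end

/-! ### The theorem: exactness at the selected bandwidth plus the Lipschitz bound. -/

theorem theorem2
    {Ω : Type*} [MeasurableSpace Ω] (P : Measure Ω) [IsProbabilityMeasure P]
    [MeasurableSpace SepBand.Surface] [BorelSpace SepBand.Surface]
    -- the random sample
    (X : ℕ → Ω → SepBand.Surface)
    (hindep : iIndepFun X P) (hident : ∀ n, IdentDistrib (X n) (X 0) P P)
    (hcentred : ∫ ω, X 0 ω ∂P = 0)
    (hA1 : SepBand.MomentCondition P (X 0))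
    -- the separable-plus-banded model for the covariance
    (A₁ A₂ : SepBand.CurveOp) (B : SepBand.SurfaceOp)
    (hA₁ : SepBand.IsTraceClass A₁ ∧ SepBand.IsPSD A₁)
    (hA₂ : SepBand.IsTraceClass A₂ ∧ SepBand.IsPSD A₂)
    (hB : SepBand.IsTraceClass B ∧ SepBand.IsPSD B)
    (hmodel : SepBand.covariance P (X 0) = SepBand.opTensor A₁ A₂ + B)
    (hstat : B ∈ SepBand.stationary)
    (δstar : ℝ) (hδstar : δstar ∈ Set.Ico (0 : ℝ) 1) (hband : SepBand.IsBanded δstar B)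
    -- the grid of candidate bandwidths
    (Δ : Finset ℝ) (hΔ : ∀ δ ∈ Δ, δ ∈ Set.Ico (0 : ℝ) 1)
    (htrace : ∀ δ ∈ Δ, SepBand.shiftedTrace δ (SepBand.covariance P (X 0)) ≠ 0)
    (hgrid : ∃ δ ∈ Δ, δstar ≤ δ)
    (hmin : δstar ∈ lowerBounds
      (SepBand.argminOn Δ (SepBand.theoreticalCriterion (SepBand.covariance P (X 0)))))
    -- the data-driven bandwidth
    (δhat : ℕ → Ω → ℝ)
    (hδhat : ∀ N, 2 ≤ N → ∀ᵐ ω ∂P,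
      δhat N ω ∈ SepBand.argminOn Δ (SepBand.cvCriterion (fun n => X n ω) N)) :
    SepBand.IsBigOInProbability P
      (fun N ω => ‖SepBand.separablePart (δhat N ω)
          (SepBand.empCov (fun n => X n ω) (Finset.range N)) - SepBand.opTensor A₁ A₂‖ ^ 2)
      (fun N => (N : ℝ)⁻¹) ∧
    SepBand.IsBigOInProbability P
      (fun N ω => ‖SepBand.bandedPart (δhat N ω)
          (SepBand.empCov (fun n => X n ω) (Finset.range N)) - B‖ ^ 2)
      (fun N => (N : ℝ)⁻¹) := by
  obtain ⟨e, he⟩ := hA1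
  have hS : SepBand.momentSum e P (X 0) ≠ ∞ := he.ne
  have hm := (hident 0).aemeasurable_fst
  have hc : SepBand.coeffNorm e (SepBand.covariance P (X 0)) ≠ ∞ :=
    ne_top_of_le_ne_top (ENNReal.pow_ne_top hS)
      (SepBand.coeffNorm_covariance_le e hm hS hcentred)
  have hsep : ∀ δ ∈ Δ, δstar ≤ δ →
      SepBand.separablePart δ (SepBand.covariance P (X 0)) = SepBand.opTensor A₁ A₂ := by
    intro δ hδ hle
    have ht := htrace δ hδ
    rw [hmodel] at ht ⊢
    exact SepBand.separablePart_opTensor_add hA₁.1 hA₂.1 hB.1 hband hle ht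
  have hbanded : ∀ δ ∈ Δ, δstar ≤ δ →
      SepBand.bandedPart δ (SepBand.covariance P (X 0)) = B := by
    intro δ hδ hle
    rw [SepBand.bandedPart, hsep δ hδ hle, hmodel, add_sub_cancel_left,
      SepBand.toeplitzAvg_of_mem hstat]
  have hzero : ∃ δ ∈ Δ,
      SepBand.theoreticalCriterion (SepBand.covariance P (X 0)) δ = 0 := by
    obtain ⟨δ, hδ, hle⟩ := hgrid
    refine ⟨δ, hδ, ?_⟩
    rw [SepBand.theoreticalCriterion, SepBand.proxy, hsep δ hδ hle, hbanded δ hδ hle, hmodel,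
      sub_self, norm_zero, zero_pow two_ne_zero]
  -- One fixed tolerance, not shrinking with `N`: selecting a good bandwidth only needs consistency,
  -- while the rate comes from the radius `r` alone.
  obtain ⟨η, hargmin, hη : 0 < η⟩ := ((SepBand.eventually_le_of_mem_argminOn_cvCriterion hc htrace
    hzero hmin).and self_mem_nhdsWithin).exists
  choose! K hK hlip using fun δ (hδ : δ ∈ Δ) =>
    SepBand.exists_norm_separablePart_sub_le e hc (htrace δ hδ)
  -- One constant for the whole grid, since the bandwidth is random. The extra `1` pays for the term
  -- `‖Ĉ - C‖ ≤ r` in the error of the banded part.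
  set L : ℝ := 1 + ∑ δ ∈ Δ, K δ with hLdef
  have hKL : ∀ δ ∈ Δ, K δ + 1 ≤ L := fun δ hδ => by
    have := Finset.single_le_sum (f := K) (fun δ hδ => (hK δ hδ).le) hδ
    linarith
  have hL : 0 < L := by
    have := Finset.sum_nonneg fun δ hδ => (hK δ hδ).le
    linarith
  obtain ⟨N₁, hN₁⟩ := exists_nat_ge
    ((SepBand.coeffNorm e (SepBand.covariance P (X 0))).toReal / η)
  have hcN : ∀ N ≥ N₁,
      SepBand.coeffNorm e (SepBand.covariance P (X 0)) ≤ ENNReal.ofReal (η * N) := by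
    intro N hN
    rw [← ENNReal.ofReal_toReal hc]
    refine ENNReal.ofReal_le_ofReal ?_
    rw [← div_le_iff₀' hη]
    exact hN₁.trans (by exact_mod_cast hN)
  have key : ∀ N ≥ max 2 N₁, ∀ᵐ ω ∂P,
      SepBand.IsTypicalSample e (SepBand.covariance P (X 0)) (fun n => X n ω) N η →
      ∀ r : ℝ, 0 ≤ r → L * r ≤ 1 →
        SepBand.coeffNorm e (SepBand.empCov (fun n => X n ω) (Finset.range N) -
          SepBand.covariance P (X 0)) ≤ ENNReal.ofReal r →
        ‖SepBand.separablePart (δhat N ω) (SepBand.empCov (fun n => X n ω) (Finset.range N)) -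
          SepBand.opTensor A₁ A₂‖ ≤ L * r ∧
        ‖SepBand.bandedPart (δhat N ω) (SepBand.empCov (fun n => X n ω) (Finset.range N)) -
          B‖ ≤ L * r := by
    intro N hN
    have hN2 : 2 ≤ N := (le_max_left _ _).trans hN
    filter_upwards [hδhat N hN2] with ω hω htyp r hr hLr hcov
    have hle := hargmin _ N hN2 (hcN N ((le_max_right _ _).trans hN)) htyp _ hω
    have hb := SepBand.norm_bandedPart_sub_le (δhat N ω)
      (SepBand.empCov (fun n => X n ω) (Finset.range N)) (SepBand.covariance P (X 0))
    rw [hbanded _ hω.1 hle] at hb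
    have hKr := mul_le_mul_of_nonneg_right (hKL _ hω.1) hr
    have hs := hlip _ hω.1 _ r hr (by nlinarith) hcov
    have hn := SepBand.norm_le_of_coeffNorm_le e hr hcov
    rw [hsep _ hω.1 hle] at hb hs
    constructor <;> linarith
  refine ⟨SepBand.isBigOInProbability_of_typical e hindep hident hcentred hS hη hL (N₀ := max 2 N₁)
      (fun N hN => ?_),
    SepBand.isBigOInProbability_of_typical e hindep hident hcentred hS hη hL (N₀ := max 2 N₁)
      (fun N hN => ?_)⟩
  · filter_upwards [key N hN] with ω hω htyp r hr hLr hcov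
    exact (hω htyp r hr hLr hcov).1
  · filter_upwards [key N hN] with ω hω htyp r hr hLr hcov
    exact (hω htyp r hr hLr hcov).2
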